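/- Let $k$ be a field. Let $A=\bigoplus_{n\ge 0}A_n$ be a Koszul algebra over $k$, i.e. $A_0=k$, $\dim_k A_1<\infty$, $A=T(A_1)/\langle R_A\rangle$ with $R_A=\ker(A_1\otimes A_1\to A_2)$, and the trivial left module $k=A/A_{\ge 1}$ has a resolution by graded projective modules $P_n$ generated in degree $n$. Let $B=A_P[y_1,y_2;\sigma]$, $P=\{p,q\}\subset k$, be a graded trimmed right double Ore extension of $A$: $B$ is a graded $k$-algebra containing $A$ as a graded subalgebra, generated by $A$ and two elements $y_1,y_2\in B_1$, such that $y_2y_1=py_1y_2+qy_1^2$, $B$ is a free left $A$-module with basis $\{y_1^iy_2^j : i,j\ge 0\}$, and $y_ja=\sigma_{j1}(a)y_1+\sigma_{j2}(a)y_2$ for all $a\in A$, $j=1,2$, where $\sigma=(\sigma_{jl}):A\to M_{2\times 2}(A)$. Then $B_1=A_1\oplus ky_1\oplus ky_2$; let $A^!=T(A_1^*)/\langle R_A^\perp\rangle$ and $B^!=T(B_1^*)/\langle R_B^\perp\rangle$ with $R_B=\ker(B_1\otimes B_1\to B_2)$, let $y_1^*,y_2^*\in B_1^*$ be the forms that vanish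 on $A_1$ with $y_j^*(y_l)=\delta_{jl}$, and let $A^!\to B^!$ be the algebra homomorphism that extends a form on $A_1$ to $B_1$ by zero on $y_1$ and $y_2$. (1) The map $A^!\to B^!$ is injective. (2) If $p\neq 0$, then $B^!$ is a free right $A^!$-module with basis $\{1,y_1^*,y_2^*,y_1^*y_2^*\}$. (3) If $B$ is a double Ore extension of $A$, i.e. it is also a left double Ore extension with the same $y_1,y_2$ (it is generated by $A,y_1,y_2$; $y_1y_2=p'y_2y_1+q'y_1^2+\tau_1'y_1+\tau_2'y_2+\tau_0'$ for some $p',q'\in k$ and $\tau'_0,\tau_1',\tau_2'\in A$; $B$ is a free right $A$-module with basis $\{y_2^iy_1^j : i,j\ge 0\}$; and $Ay_1+Ay_2\subseteq y_1A+y_2A+A$), then $B^!$ is free both as a right and as a left $A^!$-module with basis $\{1,y_1^*,y_2^*,y_1^*y_2^*\}$; that is, $B^!=A^!\oplus A^!y_1^*\oplus A^!y_2^*\oplus A^!y_1^*y_2^*=A^!\oplus y_1^*A^!\oplus y_2^*A^!\oplus y_1^*y_2^*A^!$ with each summand free of rank one. -/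

import Mathlib

open scoped TensorProduct

universe u v w

namespace KoszulOre

section QuadraticAlgebras

variable {k : Type u} [Field k]

/-- The canonical map `V ⊗ V → A`, `x ⊗ y ↦ g x * g y`, attached to a linear map `g : V → A`. -/
noncomputable def mulTensor {V : Type v} [AddCommGroup V] [Module k V]
    {A : Type w} [Ring A] [Algebra k A] (g : V →ₗ[k] A) : V ⊗[k] V →ₗ[k] A :=
  (LinearMap.mul' k A).comp (TensorProduct.map g g)

theorem mulTensor_tmul {V : Type v} [AddCommGroup V] [Module k V]
    {A : Type w} [Ring A] [Algebra k A] (g : V →ₗ[k] A) (x y : V) :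
    mulTensor g (x ⊗ₜ[k] y) = g x * g y := by
  simp [mulTensor]

/-- `T(V) / ⟨R⟩` for a subspace `R ⊆ V ⊗ V`. -/
abbrev QuadAlg {V : Type v} [AddCommGroup V] [Module k V] (R : Submodule k (V ⊗[k] V)) : Type _ :=
  RingQuot (fun s t : TensorAlgebra k V =>
    t = 0 ∧ ∃ r ∈ R, s = mulTensor (TensorAlgebra.ι k (M := V)) r)

/-- The generators: the canonical linear map `V → T(V) / ⟨R⟩`. -/
noncomputable def QuadAlg.ι {V : Type v} [AddCommGroup V] [Module k V]
    (R : Submodule k (V ⊗[k] V)) : V →ₗ[k] QuadAlg R :=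
  (RingQuot.mkAlgHom k _).toLinearMap.comp (TensorAlgebra.ι k)

theorem lift_mulTensor {V : Type v} [AddCommGroup V] [Module k V]
    {A : Type w} [Ring A] [Algebra k A] (g : V →ₗ[k] A) (r : V ⊗[k] V) :
    TensorAlgebra.lift k g (mulTensor (TensorAlgebra.ι k (M := V)) r) = mulTensor g r := by
  induction r using TensorProduct.induction_on with
  | zero => simp
  | tmul x y => simp [mulTensor_tmul]
  | add x y hx hy => simp only [map_add, hx, hy]

/-- The universal property of `T(V) / ⟨R⟩`. -/
noncomputable def QuadAlg.lift {V : Type v} [AddCommGroup V] [Module k V]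
    (R : Submodule k (V ⊗[k] V)) {A : Type w} [Ring A] [Algebra k A] (g : V →ₗ[k] A)
    (h : ∀ r ∈ R, mulTensor g r = 0) : QuadAlg R →ₐ[k] A :=
  RingQuot.liftAlgHom k ⟨TensorAlgebra.lift k g, by
    rintro s t ⟨rfl, r, hr, rfl⟩
    rw [lift_mulTensor, h r hr, map_zero]⟩

theorem QuadAlg.lift_ι {V : Type v} [AddCommGroup V] [Module k V]
    (R : Submodule k (V ⊗[k] V)) {A : Type w} [Ring A] [Algebra k A] (g : V →ₗ[k] A)
    (h : ∀ r ∈ R, mulTensor g r = 0) (x : V) : QuadAlg.lift R g h (QuadAlg.ι R x) = g x := by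
  simp [QuadAlg.lift, QuadAlg.ι, RingQuot.liftAlgHom_mkAlgHom_apply]

theorem QuadAlg.mulTensor_ι {V : Type v} [AddCommGroup V] [Module k V]
    (R : Submodule k (V ⊗[k] V)) (r : V ⊗[k] V) (hr : r ∈ R) :
    mulTensor (QuadAlg.ι R) r = 0 := by
  have h : mulTensor (QuadAlg.ι R) r
      = RingQuot.mkAlgHom k (fun s t : TensorAlgebra k V =>
          t = 0 ∧ ∃ r ∈ R, s = mulTensor (TensorAlgebra.ι k (M := V)) r)
        (mulTensor (TensorAlgebra.ι k (M := V)) r) := by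
    clear hr
    induction r using TensorProduct.induction_on with
    | zero => simp
    | tmul x y =>
      rw [mulTensor_tmul, mulTensor_tmul, map_mul]
      rfl
    | add x y hx hy => simp only [map_add, hx, hy]
  rw [h]
  exact (RingQuot.mkAlgHom_rel k ⟨rfl, r, hr, rfl⟩).trans (map_zero _)

/-- The orthogonal complement `R^⊥ ⊆ V* ⊗ V*` of `R ⊆ V ⊗ V` for the pairing
`⟨f ⊗ g, x ⊗ y⟩ = f x * g y`. -/
noncomputable def perp {V : Type v} [AddCommGroup V] [Module k V] (R : Submodule k (V ⊗[k] V)) :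
    Submodule k (Module.Dual k V ⊗[k] Module.Dual k V) :=
  R.dualAnnihilator.comap (TensorProduct.dualDistrib k V V)

/-- A linear map `π : W → V` with `(π ⊗ π)(S) ⊆ R` induces the algebra homomorphism
`T(V*) / ⟨R^⊥⟩ → T(W*) / ⟨S^⊥⟩` which is `ξ ↦ ξ ∘ π` on the generators. -/
noncomputable def dualAlgHom {V : Type v} [AddCommGroup V] [Module k V]
    {W : Type w} [AddCommGroup W] [Module k W]
    (R : Submodule k (V ⊗[k] V)) (S : Submodule k (W ⊗[k] W)) (π : W →ₗ[k] V)
    (h : ∀ s ∈ S, TensorProduct.map π π s ∈ R) : QuadAlg (perp R) →ₐ[k] QuadAlg (perp S) :=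
  QuadAlg.lift (perp R) ((QuadAlg.ι (perp S)).comp π.dualMap) (by
    intro r hr
    have h1 : mulTensor ((QuadAlg.ι (perp S)).comp π.dualMap) r
        = mulTensor (QuadAlg.ι (perp S)) (TensorProduct.map π.dualMap π.dualMap r) := by
      clear hr
      induction r using TensorProduct.induction_on with
      | zero => simp only [map_zero]
      | tmul x y =>
        rw [TensorProduct.map_tmul, mulTensor_tmul, mulTensor_tmul]
        rfl
      | add x y hx hy => simp only [map_add, hx, hy]
    rw [h1]
    apply QuadAlg.mulTensor_ι
    have h2 : ∀ s, TensorProduct.dualDistrib k W W (TensorProduct.map π.dualMap π.dualMap r) s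
        = TensorProduct.dualDistrib k V V r (TensorProduct.map π π s) := by
      intro s
      clear h1 hr
      induction r using TensorProduct.induction_on with
      | zero => simp
      | add x y hx hy => simp only [map_add, LinearMap.add_apply, hx, hy]
      | tmul f g =>
        induction s using TensorProduct.induction_on with
        | zero => simp
        | add x y hx hy => simp only [map_add, hx, hy]
        | tmul a b => simp
    simp only [perp, Submodule.mem_comap, Submodule.mem_dualAnnihilator] at hr ⊢
    intro s hs
    rw [h2]
    exact hr _ (h s hs))

end QuadraticAlgebras

section GradedAlgebras

variable {k : Type u} [Field k] {A : Type v} [Ring A] [Algebra k A]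

/-- The quadratic relations of a graded algebra: the kernel of the multiplication
`A₁ ⊗ A₁ → A₂`. -/
noncomputable def relations (𝒜 : ℕ → Submodule k A) : Submodule k (𝒜 1 ⊗[k] 𝒜 1) :=
  LinearMap.ker (mulTensor (𝒜 1).subtype)

/-- A graded algebra is quadratic: it is connected, `A₁` is finite-dimensional, and
`A = T(A₁) / ⟨R⟩`, where `R ⊆ A₁ ⊗ A₁` is the space of its quadratic relations. -/
structure IsQuadratic (𝒜 : ℕ → Submodule k A) : Prop where
  nontrivial : Nontrivial A
  connected : 𝒜 0 = 1
  finite : FiniteDimensional k (𝒜 1)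
  bijective : Function.Bijective
    (QuadAlg.lift (relations 𝒜) (𝒜 1).subtype (fun _ hr => hr))

/-- A linear resolution of the trivial left module `A / A₊`: an exact sequence
`⋯ → P₂ → P₁ → P₀ → A / A₊ → 0` of graded left modules and homomorphisms of degree zero with `Pₙ`
projective and generated in degree `n`. (As `A` lives in degrees `≥ 0`, such a `Pₙ` lives in
degrees `≥ n`, so that gradings by `ℕ` suffice, and every module map `P₀ → A / A₊` is graded.) -/
structure LinearResolution (𝒜 : ℕ → Submodule k A) [GradedAlgebra 𝒜] where
  P : ℕ → Type v
  [addCommGroup : ∀ n, AddCommGroup (P n)]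
  [module : ∀ n, Module A (P n)]
  grading : ∀ n, ℕ → AddSubgroup (P n)
  isInternal : ∀ n, DirectSum.IsInternal (grading n)
  smul_mem : ∀ n i j, ∀ a ∈ 𝒜 i, ∀ x ∈ grading n j, a • x ∈ grading n (i + j)
  projective : ∀ n, Module.Projective A (P n)
  generated : ∀ n, Submodule.span A (grading n n : Set (P n)) = ⊤
  d : ∀ n, P (n + 1) →ₗ[A] P n
  d_mem : ∀ n j, ∀ x ∈ grading (n + 1) j, d n x ∈ grading n j
  ε : P 0 →ₗ[A] A ⧸ (HomogeneousIdeal.irrelevant 𝒜).toIdeal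
  ε_surjective : Function.Surjective ε
  exact_zero : Function.Exact (d 0) ε
  exact_succ : ∀ n, Function.Exact (d (n + 1)) (d n)

/-- Koszul algebras. -/
structure IsKoszul (𝒜 : ℕ → Submodule k A) [GradedAlgebra 𝒜] : Prop where
  isQuadratic : IsQuadratic 𝒜
  resolution : Nonempty (LinearResolution 𝒜)

/-- The homogeneous dual `A^! = T(A₁*) / ⟨R^⊥⟩`. -/
abbrev KoszulDual (𝒜 : ℕ → Submodule k A) : Type _ := QuadAlg (perp (relations 𝒜))

/-- The element of `A^!` of degree one given by a linear form on `A₁`. -/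
noncomputable abbrev KoszulDual.ι (𝒜 : ℕ → Submodule k A) :
    Module.Dual k (𝒜 1) →ₗ[k] KoszulDual 𝒜 :=
  QuadAlg.ι (perp (relations 𝒜))

end GradedAlgebras

section FreeModules

/-- Along a ring homomorphism `f : R → S`, the family `v` is a basis of `S` as a left `R`-module:
every `s` is `∑ j, f (c j) * v j` for exactly one finitely supported family `c`. -/
def IsLeftBasis {R S J : Type*} [Ring R] [Ring S] (f : R →+* S) (v : J → S) : Prop :=
  Function.Bijective (fun c : J →₀ R => c.sum fun j a => f a * v j)

/-- The same for `S` as a right `R`-module. -/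
def IsRightBasis {R S J : Type*} [Ring R] [Ring S] (f : R →+* S) (v : J → S) : Prop :=
  Function.Bijective (fun c : J →₀ R => c.sum fun j a => v j * f a)

end FreeModules

section DoubleOre

variable {k : Type u} [Field k] {A : Type v} [Ring A] [Algebra k A]
  {B : Type w} [Ring B] [Algebra k B]

/-- `B = A_P[y₁, y₂; σ, δ, τ]` is a right double Ore extension of `A`, which is embedded by `i`;
the indices `0`, `1` of `Fin 2` stand for the variables `y₁`, `y₂`. -/
structure IsRightDoubleOre (i : A →ₐ[k] B) (y₁ y₂ : B) (p q : k)
    (σ : A → Matrix (Fin 2) (Fin 2) A) (δ : A → Fin 2 → A) (τ₀ τ₁ τ₂ : A) : Prop where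
  injective : Function.Injective i
  generated : Algebra.adjoin k (Set.range i ∪ {y₁, y₂}) = ⊤
  relation : y₂ * y₁ = p • (y₁ * y₂) + q • y₁ ^ 2 + i τ₁ * y₁ + i τ₂ * y₂ + i τ₀
  basis : IsLeftBasis (i : A →+* B) (fun m : ℕ × ℕ => y₁ ^ m.1 * y₂ ^ m.2)
  comm₁ : ∀ a, y₁ * i a = i (σ a 0 0) * y₁ + i (σ a 0 1) * y₂ + i (δ a 0)
  comm₂ : ∀ a, y₂ * i a = i (σ a 1 0) * y₁ + i (σ a 1 1) * y₂ + i (δ a 1)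

/-- `B` is a left double Ore extension of `A`, which is embedded by `i`. -/
structure IsLeftDoubleOre (i : A →ₐ[k] B) (y₁ y₂ : B) : Prop where
  injective : Function.Injective i
  generated : Algebra.adjoin k (Set.range i ∪ {y₁, y₂}) = ⊤
  relation : ∃ (p' q' : k) (τ₀ τ₁ τ₂ : A),
    y₁ * y₂ = p' • (y₂ * y₁) + q' • y₁ ^ 2 + i τ₁ * y₁ + i τ₂ * y₂ + i τ₀
  basis : IsRightBasis (i : A →+* B) (fun m : ℕ × ℕ => y₂ ^ m.1 * y₁ ^ m.2)
  comm₁ : ∀ a, ∃ a₁ a₂ a₀ : A, i a * y₁ = y₁ * i a₁ + y₂ * i a₂ + i a₀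
  comm₂ : ∀ a, ∃ a₁ a₂ a₀ : A, i a * y₂ = y₁ * i a₁ + y₂ * i a₂ + i a₀

/-- `B = A_P[y₁, y₂; σ]` is a trimmed right double Ore extension of `A` (that is, `δ = 0` and
`τ = 0`) in the category of graded algebras, with `y₁`, `y₂` of degree one. -/
structure IsTrimmedRightDoubleOre (𝒜 : ℕ → Submodule k A) (ℬ : ℕ → Submodule k B)
    (i : A →ₐ[k] B) (y₁ y₂ : B) (p q : k) (σ : A → Matrix (Fin 2) (Fin 2) A) : Prop where
  rightDoubleOre : IsRightDoubleOre i y₁ y₂ p q σ 0 0 0 0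
  map_mem : ∀ n, ∀ a ∈ 𝒜 n, i a ∈ ℬ n
  y₁_mem : y₁ ∈ ℬ 1
  y₂_mem : y₂ ∈ ℬ 1

namespace IsTrimmedRightDoubleOre

variable {𝒜 : ℕ → Submodule k A} {ℬ : ℕ → Submodule k B}
  {i : A →ₐ[k] B} {y₁ y₂ : B} {p q : k} {σ : A → Matrix (Fin 2) (Fin 2) A}

/-- The linear map `A₁ ⊕ k ⊕ k → B₁`, `(a, s, t) ↦ a + s y₁ + t y₂`. -/
noncomputable def degreeOneMap (hB : IsTrimmedRightDoubleOre 𝒜 ℬ i y₁ y₂ p q σ) :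
    (𝒜 1 × k × k) →ₗ[k] ℬ 1 where
  toFun x := ⟨i x.1 + x.2.1 • y₁ + x.2.2 • y₂,
    add_mem (add_mem (hB.map_mem 1 _ x.1.2) ((ℬ 1).smul_mem _ hB.y₁_mem))
      ((ℬ 1).smul_mem _ hB.y₂_mem)⟩
  map_add' x z := by
    apply Subtype.ext
    simp only [Prod.fst_add, Prod.snd_add, Submodule.coe_add, map_add, add_smul]
    abel
  map_smul' c x := by
    apply Subtype.ext
    simp [smul_add, smul_smul]

/-- The coefficient of `y₁ ^ 0 * y₂ ^ 0` is additive and has the expected values. -/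
theorem exists_coeff (hB : IsTrimmedRightDoubleOre 𝒜 ℬ i y₁ y₂ p q σ) :
    ∃ P : B →+ (ℕ × ℕ →₀ A), Function.Injective P ∧
      ∀ a m n, P (i a * (y₁ ^ m * y₂ ^ n)) = Finsupp.single (m, n) a := by
  classical
  have hb := hB.rightDoubleOre.basis
  let F : (ℕ × ℕ →₀ A) →+ B :=
    { toFun := fun c => c.sum fun j a => (i : A →+* B) a * (y₁ ^ j.1 * y₂ ^ j.2)
      map_zero' := by simp
      map_add' := fun c d => by
        apply Finsupp.sum_add_index'
        · simp
        · intro j a b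
          rw [map_add, add_mul] }
  have hF : Function.Bijective F := hb
  let e := AddEquiv.ofBijective F hF
  refine ⟨e.symm.toAddMonoidHom, e.symm.injective, fun a m n => ?_⟩
  change e.symm _ = _
  rw [AddEquiv.symm_apply_eq]
  change _ = F _
  simp [F]

theorem degreeOneMap_bijective [GradedAlgebra 𝒜] [GradedAlgebra ℬ] (hA : IsQuadratic 𝒜)
    (hB : IsTrimmedRightDoubleOre 𝒜 ℬ i y₁ y₂ p q σ) :
    Function.Bijective hB.degreeOneMap := by
  classical
  have := hA.nontrivial
  obtain ⟨P, hP, hPv⟩ := hB.exists_coeff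
  constructor
  · rw [injective_iff_map_eq_zero]
    rintro ⟨a, s, t⟩ h
    have h0 : i (a : A) + s • y₁ + t • y₂ = 0 := congrArg Subtype.val h
    have h1 : i (a : A) * (y₁ ^ 0 * y₂ ^ 0) + i (algebraMap k A s) * (y₁ ^ 1 * y₂ ^ 0)
        + i (algebraMap k A t) * (y₁ ^ 0 * y₂ ^ 1) = 0 := by
      simpa [Algebra.smul_def] using h0
    have h2 := congrArg P h1
    rw [map_add, map_add, hPv, hPv, hPv, map_zero] at h2
    have ha := DFunLike.congr_fun h2 (0, 0)
    have hs := DFunLike.congr_fun h2 (1, 0)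
    have ht := DFunLike.congr_fun h2 (0, 1)
    simp at ha hs ht
    simp [ha, hs, ht]
  · have key : ∀ (a : A) (m n : ℕ), ∃ x, (hB.degreeOneMap x : B)
        = GradedRing.proj ℬ 1 (i a * (y₁ ^ m * y₂ ^ n)) := by
      intro a m n
      have hy : y₁ ^ m * y₂ ^ n ∈ ℬ (m + n) := by
        have h1 := SetLike.pow_mem_graded m hB.y₁_mem
        have h2 := SetLike.pow_mem_graded n hB.y₂_mem
        simpa using SetLike.mul_mem_graded h1 h2
      induction a using DirectSum.Decomposition.inductionOn 𝒜 with
      | zero => exact ⟨0, by simp⟩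
      | add a b ha hb =>
        obtain ⟨x, hx⟩ := ha
        obtain ⟨z, hz⟩ := hb
        exact ⟨x + z, by rw [map_add, map_add, add_mul, map_add, Submodule.coe_add, hx, hz]⟩
      | @homogeneous d a =>
        have hm : i a * (y₁ ^ m * y₂ ^ n) ∈ ℬ (d + (m + n)) :=
          SetLike.mul_mem_graded (hB.map_mem d a a.2) hy
        by_cases hd : d + (m + n) = 1
        · rw [hd] at hm
          rw [GradedRing.proj_apply, DirectSum.decompose_of_mem_same _ hm]
          have hcases : (d = 1 ∧ m = 0 ∧ n = 0) ∨ (d = 0 ∧ m = 1 ∧ n = 0)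
              ∨ (d = 0 ∧ m = 0 ∧ n = 1) := by omega
          rcases hcases with ⟨rfl, rfl, rfl⟩ | ⟨rfl, rfl, rfl⟩ | ⟨rfl, rfl, rfl⟩
          · exact ⟨(a, 0, 0), by simp [degreeOneMap]⟩
          · have ha : (a : A) ∈ (1 : Submodule k A) := hA.connected ▸ a.2
            obtain ⟨s, hs⟩ := Submodule.mem_one.1 ha
            exact ⟨(0, s, 0), by simp [degreeOneMap, ← hs, Algebra.smul_def]⟩
          · have ha : (a : A) ∈ (1 : Submodule k A) := hA.connected ▸ a.2
            obtain ⟨s, hs⟩ := Submodule.mem_one.1 ha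
            exact ⟨(0, 0, s), by simp [degreeOneMap, ← hs, Algebra.smul_def]⟩
        · rw [GradedRing.proj_apply, DirectSum.decompose_of_mem_ne _ hm hd]
          exact ⟨0, by simp⟩
    have key2 : ∀ c : ℕ × ℕ →₀ A, ∃ x, (hB.degreeOneMap x : B)
        = GradedRing.proj ℬ 1 (c.sum fun j a => (i : A →+* B) a * (y₁ ^ j.1 * y₂ ^ j.2)) := by
      intro c
      choose g hg using key
      refine ⟨∑ j ∈ c.support, g (c j) j.1 j.2, ?_⟩
      rw [Finsupp.sum, map_sum, map_sum, Submodule.coe_sum]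
      exact Finset.sum_congr rfl fun j _ => hg _ _ _
    intro b
    obtain ⟨c, hc⟩ := hB.rightDoubleOre.basis.2 (b : B)
    obtain ⟨x, hx⟩ := key2 c
    refine ⟨x, Subtype.ext ?_⟩
    rw [hx]
    simp only at hc
    rw [hc, GradedRing.proj_apply, DirectSum.decompose_of_mem_same _ b.2]

/-- `B₁ = A₁ ⊕ k y₁ ⊕ k y₂`. -/
noncomputable def degreeOneEquiv [GradedAlgebra 𝒜] [GradedAlgebra ℬ] (hA : IsQuadratic 𝒜)
    (hB : IsTrimmedRightDoubleOre 𝒜 ℬ i y₁ y₂ p q σ) : (𝒜 1 × k × k) ≃ₗ[k] ℬ 1 :=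
  LinearEquiv.ofBijective hB.degreeOneMap (hB.degreeOneMap_bijective hA)

/-- The projection `B₁ = A₁ ⊕ k y₁ ⊕ k y₂ → A₁`. -/
noncomputable def toA [GradedAlgebra 𝒜] [GradedAlgebra ℬ] (hA : IsQuadratic 𝒜)
    (hB : IsTrimmedRightDoubleOre 𝒜 ℬ i y₁ y₂ p q σ) : ℬ 1 →ₗ[k] 𝒜 1 :=
  (LinearMap.fst k (𝒜 1) (k × k)).comp (hB.degreeOneEquiv hA).symm.toLinearMap

/-- The linear form on `B₁ = A₁ ⊕ k y₁ ⊕ k y₂` that is `1` at `y₁` and zero on `A₁` and at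
`y₂`, as an element `y₁*` of `B^!`. -/
noncomputable def y₁Dual [GradedAlgebra 𝒜] [GradedAlgebra ℬ] (hA : IsQuadratic 𝒜)
    (hB : IsTrimmedRightDoubleOre 𝒜 ℬ i y₁ y₂ p q σ) : KoszulDual ℬ :=
  KoszulDual.ι ℬ (((LinearMap.fst k k k).comp (LinearMap.snd k (𝒜 1) (k × k))).comp
    (hB.degreeOneEquiv hA).symm.toLinearMap)

/-- The linear form on `B₁ = A₁ ⊕ k y₁ ⊕ k y₂` that is `1` at `y₂` and zero on `A₁` and at
`y₁`, as an element `y₂*` of `B^!`. -/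
noncomputable def y₂Dual [GradedAlgebra 𝒜] [GradedAlgebra ℬ] (hA : IsQuadratic 𝒜)
    (hB : IsTrimmedRightDoubleOre 𝒜 ℬ i y₁ y₂ p q σ) : KoszulDual ℬ :=
  KoszulDual.ι ℬ (((LinearMap.snd k k k).comp (LinearMap.snd k (𝒜 1) (k × k))).comp
    (hB.degreeOneEquiv hA).symm.toLinearMap)

theorem map_toA_mem_relations [GradedAlgebra 𝒜] [GradedAlgebra ℬ] (hA : IsQuadratic 𝒜)
    (hB : IsTrimmedRightDoubleOre 𝒜 ℬ i y₁ y₂ p q σ) (r : ℬ 1 ⊗[k] ℬ 1)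
    (hr : r ∈ relations ℬ) :
    TensorProduct.map (hB.toA hA) (hB.toA hA) r ∈ relations 𝒜 := by
  classical
  obtain ⟨P, -, hPv⟩ := hB.exists_coeff
  have hrel : y₂ * y₁ = p • (y₁ * y₂) + q • y₁ ^ 2 := by
    simpa using hB.rightDoubleOre.relation
  have hc₁ : ∀ a, y₁ * i a = i (σ a 0 0) * y₁ + i (σ a 0 1) * y₂ := fun a => by
    simpa using hB.rightDoubleOre.comm₁ a
  have hc₂ : ∀ a, y₂ * i a = i (σ a 1 0) * y₁ + i (σ a 1 1) * y₂ := fun a => by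
    simpa using hB.rightDoubleOre.comm₂ a
  have v0 : ∀ a, P (i a) (0, 0) = a := fun a => by
    have := hPv a 0 0
    simp only [pow_zero, mul_one] at this
    simp [this]
  have v1 : ∀ a, P (i a * y₁) (0, 0) = 0 := fun a => by
    have := hPv a 1 0
    simp only [pow_zero, pow_one, mul_one] at this
    simp [this]
  have v2 : ∀ a, P (i a * y₂) (0, 0) = 0 := fun a => by
    have := hPv a 0 1
    simp only [pow_zero, pow_one, one_mul] at this
    simp [this]
  have v11 : ∀ a, P (i a * (y₁ * y₁)) (0, 0) = 0 := fun a => by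
    have := hPv a 2 0
    simp only [pow_zero, pow_two, mul_one] at this
    simp [this]
  have v12 : ∀ a, P (i a * (y₁ * y₂)) (0, 0) = 0 := fun a => by
    have := hPv a 1 1
    simp only [pow_one] at this
    simp [this]
  have v22 : ∀ a, P (i a * (y₂ * y₂)) (0, 0) = 0 := fun a => by
    have := hPv a 0 2
    simp only [pow_zero, pow_two, one_mul] at this
    simp [this]
  have hmul : ∀ (a b : A) (s t s' t' : k),
      P ((i a + s • y₁ + t • y₂) * (i b + s' • y₁ + t' • y₂)) (0, 0) = a * b := by
    intro a b s t s' t'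
    have sm : ∀ (c : k) (z : B), c • z = i (algebraMap k A c) * z := fun c z => by
      rw [AlgHom.commutes, Algebra.smul_def]
    have e : (i a + s • y₁ + t • y₂) * (i b + s' • y₁ + t' • y₂)
        = i (a * b) + i (s' • a + s • σ b 0 0 + t • σ b 1 0) * y₁
          + i (t' • a + s • σ b 0 1 + t • σ b 1 1) * y₂
          + i (algebraMap k A (s * s' + t * s' * q)) * (y₁ * y₁)
          + i (algebraMap k A (s * t' + t * s' * p)) * (y₁ * y₂)
          + i (algebraMap k A (t * t')) * (y₂ * y₂) := by
      rw [← sm, ← sm, ← sm]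
      simp only [add_mul, mul_add, smul_mul_assoc, mul_smul_comm, hc₁, hc₂, hrel, map_mul,
        map_add, map_smul, smul_add, smul_smul, add_smul, pow_two]
      rw [show t * s' * p = s' * (t * p) by ring, show t * s' * q = s' * (t * q) by ring,
        mul_comm s s', mul_comm s t', mul_comm t t']
      abel
    rw [e]
    simp only [map_add P, Finsupp.add_apply, v0, v1, v2, v11, v12, v22, add_zero]
  have hgen : ∀ r : ℬ 1 ⊗[k] ℬ 1, P (mulTensor (ℬ 1).subtype r) (0, 0)
      = mulTensor (𝒜 1).subtype (TensorProduct.map (hB.toA hA) (hB.toA hA) r) := by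
    intro r
    induction r using TensorProduct.induction_on with
    | zero => simp
    | add x z hx hz => simp only [map_add, Finsupp.add_apply, hx, hz]
    | tmul b c =>
      obtain ⟨⟨a, s, t⟩, rfl⟩ := (hB.degreeOneEquiv hA).surjective b
      obtain ⟨⟨a', s', t'⟩, rfl⟩ := (hB.degreeOneEquiv hA).surjective c
      have h := hmul a a' s t s' t'
      have hA' : ∀ x, hB.toA hA (hB.degreeOneEquiv hA x) = x.1 := fun x => by
        change ((hB.degreeOneEquiv hA).symm (hB.degreeOneEquiv hA x)).1 = x.1
        rw [LinearEquiv.symm_apply_apply]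
      rw [TensorProduct.map_tmul, mulTensor_tmul, mulTensor_tmul, hA', hA']
      exact h
  have h0 : mulTensor (ℬ 1).subtype r = 0 := hr
  change mulTensor (𝒜 1).subtype _ = 0
  rw [← hgen, h0]
  simp

/-- The canonical map `A^! → B^!`: on degree one it extends a linear form on `A₁` to
`B₁ = A₁ ⊕ k y₁ ⊕ k y₂` by zero on `y₁` and `y₂`. -/
noncomputable def dualMap [GradedAlgebra 𝒜] [GradedAlgebra ℬ] (hA : IsQuadratic 𝒜)
    (hB : IsTrimmedRightDoubleOre 𝒜 ℬ i y₁ y₂ p q σ) : KoszulDual 𝒜 →ₐ[k] KoszulDual ℬ :=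
  dualAlgHom (relations 𝒜) (relations ℬ) (hB.toA hA) (hB.map_toA_mem_relations hA)

end IsTrimmedRightDoubleOre

end DoubleOre

end KoszulOre

/-! Only degrees one and two of `B` matter. Put `ρ = !![-q, -p; 1, 0]`, so that the relation between
the new variables is `∑ ρ_{jl} y_j y_l = 0`. Dualizing this relation and the rule `y_j a = ∑
σ_{jl}(a) y_l` gives in `B^!` the rules `f y_l* = -∑ y_j* (f ∘ σ_{jl})` and `y_l* y_m* = ρ_{lm} z`
with `z = y₂* y₁*`. As `ρ` vanishes at `(2, 2)`, also `y_l* z = 0`. Hence `1, y₁*, y₂*, z` span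
`B^!` as a right `A^!`-module.

For independence, `B^!` is made to act on four copies of `A^!` exactly as these rules dictate
(`diag`, `shift`). An element `a` of `A^!` acts by multiplication on the first copy, by a matrix `Φ
a` on the middle two and by `Δ a` on the last. `Φ` exists because `σ` is multiplicative. Moving `a ∈
A` through the relation and comparing coefficients gives `∑ ρ_{jn} σ_{jl} σ_{nm} = ρ_{lm} D`, where
`D` is a quantum determinant of `σ`. This identity makes `Δ : f ↦ f ∘ D` well defined and compatible
with the other rules. The relations `R_B^⊥` then act by zero (`mulTensor_genAction`), and acting on
`(1, 0, 0)` recovers the coordinates, so `θ` is bijective.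

The first coordinate gives (1). Since `y₁* y₂* = -p z`, (2) follows. In (3), the left double Ore
structure forces `p ≠ 0` and makes the matrix `σ` on `A₁` invertible. Then `D` is invertible, and
the rules that move `A^!` past `y_l*` and `z` are bijections between left and right coordinates
(`θLeft_bijective`). -/

namespace KoszulOre

/-! ### Quadratic algebras and homomorphisms between quadratic duals -/

section QuadraticAlgebras

variable {k : Type u} [Field k] {V : Type v} [AddCommGroup V] [Module k V]

/-- `T(V) / ⟨R⟩` as a type of its own, all of whose algebraic structure comes from its ring and
`k`-algebra structures. -/
def Quad (R : Submodule k (V ⊗[k] V)) : Type _ := QuadAlg R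

noncomputable instance (R : Submodule k (V ⊗[k] V)) : Ring (Quad R) :=
  inferInstanceAs (Ring (QuadAlg R))

noncomputable instance (R : Submodule k (V ⊗[k] V)) : Algebra k (Quad R) :=
  inferInstanceAs (Algebra k (QuadAlg R))

/-- The generators of `T(V) / ⟨R⟩`. -/
noncomputable def Quad.ι (R : Submodule k (V ⊗[k] V)) : V →ₗ[k] Quad R := QuadAlg.ι R

/-- The universal property of `T(V) / ⟨R⟩`. -/
noncomputable def Quad.lift (R : Submodule k (V ⊗[k] V)) {A : Type w} [Ring A] [Algebra k A]
    (g : V →ₗ[k] A) (h : ∀ r ∈ R, mulTensor g r = 0) : Quad R →ₐ[k] A :=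
  QuadAlg.lift R g h

theorem Quad.lift_ι (R : Submodule k (V ⊗[k] V)) {A : Type w} [Ring A] [Algebra k A]
    (g : V →ₗ[k] A) (h : ∀ r ∈ R, mulTensor g r = 0) (x : V) :
    Quad.lift R g h (Quad.ι R x) = g x :=
  QuadAlg.lift_ι R g h x

theorem Quad.mulTensor_ι (R : Submodule k (V ⊗[k] V)) (r : V ⊗[k] V) (hr : r ∈ R) :
    mulTensor (Quad.ι R) r = 0 :=
  QuadAlg.mulTensor_ι R r hr

theorem mulTensor_comp_map {V' : Type*} [AddCommGroup V'] [Module k V']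
    {A : Type*} [Ring A] [Algebra k A] (g : V →ₗ[k] A) (a b : V' →ₗ[k] V) (r : V' ⊗[k] V') :
    mulTensor g (TensorProduct.map a b r) =
      LinearMap.mul' k A (TensorProduct.map (g ∘ₗ a) (g ∘ₗ b) r) := by
  rw [TensorProduct.map_comp]
  rfl

theorem mulTensor_algHom_comp {A A' : Type*} [Ring A] [Algebra k A] [Ring A'] [Algebra k A']
    (F : A →ₐ[k] A') (g : V →ₗ[k] A) (r : V ⊗[k] V) :
    mulTensor (F.toLinearMap ∘ₗ g) r = F (mulTensor g r) := by
  induction r using TensorProduct.induction_on with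
  | zero => simp
  | tmul x y => simp [mulTensor_tmul]
  | add x y hx hy => simp only [map_add, hx, hy]

theorem Quad.exists_mkAlgHom (R : Submodule k (V ⊗[k] V)) :
    ∃ F : TensorAlgebra k V →ₐ[k] Quad R, Function.Surjective F ∧
      ∀ x, F (TensorAlgebra.ι k x) = Quad.ι R x :=
  ⟨RingQuot.mkAlgHom k (fun s t : TensorAlgebra k V =>
          t = 0 ∧ ∃ r ∈ R, s = mulTensor (TensorAlgebra.ι k (M := V)) r),
    RingQuot.mkAlgHom_surjective k _, fun _ => rfl⟩

/-- An induction principle for `T(V) / ⟨R⟩`: scalars, left multiplication by generators, sums. -/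
theorem Quad.induction_left {R : Submodule k (V ⊗[k] V)} {C : Quad R → Prop}
    (one : C 1) (smul : ∀ (c : k) a, C a → C (c • a)) (add : ∀ a b, C a → C b → C (a + b))
    (mul : ∀ x a, C a → C (Quad.ι R x * a)) (a : Quad R) : C a := by
  obtain ⟨F, hF, hι⟩ := Quad.exists_mkAlgHom R
  obtain ⟨t, rfl⟩ := hF a
  -- With an arbitrary right factor `a`, the case of a product `s * t` follows by applying the two
  -- hypotheses in turn.
  suffices h : ∀ a : Quad R, C a → C (F t * a) by
    simpa using h 1 one
  induction t using TensorAlgebra.induction with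
  | algebraMap c =>
    intro a ha
    rw [AlgHom.commutes, ← Algebra.smul_def]
    exact smul c a ha
  | ι x =>
    intro a ha
    rw [hι]
    exact mul x a ha
  | mul s t hs ht =>
    intro a ha
    rw [map_mul, mul_assoc]
    exact hs _ (ht _ ha)
  | add s t hs ht =>
    intro a ha
    rw [map_add, add_mul]
    exact add _ _ (hs _ ha) (ht _ ha)

theorem Quad.algHom_ext {R : Submodule k (V ⊗[k] V)} {A : Type*} [Ring A] [Algebra k A]
    {F G : Quad R →ₐ[k] A} (h : ∀ x, F (Quad.ι R x) = G (Quad.ι R x)) : F = G := by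
  refine AlgHom.ext fun a => ?_
  induction a using Quad.induction_left with
  | one => simp
  | smul c a ha => simp [ha]
  | add a b ha hb => simp [ha, hb]
  | mul x a ha => simp [ha, h]

theorem dualDistrib_map_dualMap {V' : Type*} [AddCommGroup V'] [Module k V']
    (a b : V →ₗ[k] V') (r : Module.Dual k V' ⊗[k] Module.Dual k V') (s : V ⊗[k] V) :
    TensorProduct.dualDistrib k V V (TensorProduct.map a.dualMap b.dualMap r) s
      = TensorProduct.dualDistrib k V' V' r (TensorProduct.map a b s) := by
  induction r using TensorProduct.induction_on with
  | zero => simp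
  | add x y hx hy => simp only [map_add, LinearMap.add_apply, hx, hy]
  | tmul f g =>
    induction s using TensorProduct.induction_on with
    | zero => simp
    | add x y hx hy => simp only [map_add, hx, hy]
    | tmul a b => simp

theorem mem_perp {R : Submodule k (V ⊗[k] V)} {r : Module.Dual k V ⊗[k] Module.Dual k V} :
    r ∈ perp R ↔ ∀ s ∈ R, TensorProduct.dualDistrib k V V r s = 0 := by
  simp [perp, Submodule.mem_dualAnnihilator]

/-- The algebra homomorphism of quadratic duals induced by a linear map of generators. -/
noncomputable def dualHom {W : Type w} [AddCommGroup W] [Module k W]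
    (R : Submodule k (V ⊗[k] V)) (S : Submodule k (W ⊗[k] W)) (π : W →ₗ[k] V)
    (h : ∀ s ∈ S, TensorProduct.map π π s ∈ R) : Quad (perp R) →ₐ[k] Quad (perp S) :=
  dualAlgHom R S π h

theorem dualHom_ι {W : Type w} [AddCommGroup W] [Module k W]
    (R : Submodule k (V ⊗[k] V)) (S : Submodule k (W ⊗[k] W)) (π : W →ₗ[k] V)
    (h : ∀ s ∈ S, TensorProduct.map π π s ∈ R) (f : Module.Dual k V) :
    dualHom R S π h (Quad.ι _ f) = Quad.ι (perp S) (f ∘ₗ π) := by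
  unfold dualHom dualAlgHom
  exact QuadAlg.lift_ι (A := QuadAlg (perp S)) ..

/-- The linear map `f ↦ (-f ∘ s_{jl})` from `V*` to matrices over the quadratic dual. -/
noncomputable def dualMatrix {n : Type*} (R : Submodule k (V ⊗[k] V)) (s : n → n → V →ₗ[k] V) :
    Module.Dual k V →ₗ[k] Matrix n n (Quad (perp R)) where
  toFun f := Matrix.of fun j l => -Quad.ι (perp R) (f ∘ₗ s j l)
  map_add' f g := by
    ext j l
    simp [LinearMap.add_comp, add_comm]
  map_smul' c f := by
    ext j l
    simp [LinearMap.smul_comp]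

theorem dualMatrix_apply {n : Type*} (R : Submodule k (V ⊗[k] V)) (s : n → n → V →ₗ[k] V)
    (f : Module.Dual k V) (j l : n) :
    dualMatrix R s f j l = -Quad.ι (perp R) (f ∘ₗ s j l) := rfl

/-- The algebra endomorphism of `T(V*) / ⟨R^⊥⟩` induced by a matrix of endomorphisms of `V` which
respects `R`. -/
noncomputable def dualMatrixHom {n : Type*} [Fintype n] [DecidableEq n]
    (R : Submodule k (V ⊗[k] V)) (s : n → n → V →ₗ[k] V)
    (h : ∀ r ∈ R, ∀ j l, ∑ m, TensorProduct.map (s j m) (s m l) r ∈ R) :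
    Quad (perp R) →ₐ[k] Matrix n n (Quad (perp R)) :=
  Quad.lift (perp R) (dualMatrix R s) (by
    intro r hr
    ext j l
    have h1 : mulTensor (dualMatrix R s) r j l = mulTensor (Quad.ι (perp R))
            (∑ m, TensorProduct.map (s j m).dualMap (s m l).dualMap r) := by
      clear hr
      induction r using TensorProduct.induction_on with
      | zero => simp
      | tmul x y =>
        simp only [mulTensor_tmul, Matrix.mul_apply, map_sum, TensorProduct.map_tmul,
          dualMatrix_apply, neg_mul_neg]
        rfl
      | add x y hx hy =>
        simp only [map_add, Matrix.add_apply, hx, hy, Finset.sum_add_distrib]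
    rw [h1, Matrix.zero_apply]
    apply Quad.mulTensor_ι
    rw [mem_perp] at hr ⊢
    intro t ht
    rw [map_sum, LinearMap.sum_apply]
    simp only [dualDistrib_map_dualMap]
    rw [← map_sum]
    exact hr _ (h t ht j l))

theorem dualMatrixHom_ι {n : Type*} [Fintype n] [DecidableEq n]
    (R : Submodule k (V ⊗[k] V)) (s : n → n → V →ₗ[k] V)
    (h : ∀ r ∈ R, ∀ j l, ∑ m, TensorProduct.map (s j m) (s m l) r ∈ R) (f : Module.Dual k V)
    (j l : n) :
    dualMatrixHom R s h (Quad.ι _ f) j l = -Quad.ι _ (f ∘ₗ s j l) := by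
  rw [dualMatrixHom, Quad.lift_ι, dualMatrix_apply]

end QuadraticAlgebras

/-! ### The dual of a double extension is free as a right module -/

section DualExtension

/-- The linear data behind a trimmed double Ore extension: `W = V ⊕ k Y₀ ⊕ k Y₁`, with quadratic
relations `S ⊆ W ⊗ W` and `R ⊆ V ⊗ V`, commutation rules `Y_j a = ∑ s_{jl}(a) Y_l`, and the single
relation `∑ ρ_{jl} Y_j Y_l = 0` between the new variables. -/
structure DualExtension {k : Type u} [Field k] {V : Type v} [AddCommGroup V] [Module k V]
    {W : Type w} [AddCommGroup W] [Module k W]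
    (R : Submodule k (V ⊗[k] V)) (S : Submodule k (W ⊗[k] W)) where
  π : W →ₗ[k] V
  incl : V →ₗ[k] W
  η : Fin 2 → Module.Dual k W
  Y : Fin 2 → W
  s : Fin 2 → Fin 2 → V →ₗ[k] V
  ρ : Fin 2 → Fin 2 → k
  D : V →ₗ[k] V
  π_incl : ∀ a, π (incl a) = a
  π_Y : ∀ j, π (Y j) = 0
  η_incl : ∀ j a, η j (incl a) = 0
  η_Y : ∀ j l, η j (Y l) = if j = l then 1 else 0
  decomp : ∀ x, x = incl (π x) + ∑ j, η j x • Y j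
  s_mem : ∀ r ∈ R, ∀ j l, ∑ m, TensorProduct.map (s j m) (s m l) r ∈ R
  ρ_one_zero : ρ 1 0 = 1
  ρ_one_one : ρ 1 1 = 0
  -- The coefficient of `Y_l Y_m` after moving `a` through `∑ ρ_{jn} Y_j Y_n`. It must be a multiple
  -- of the only relation between the `Y`'s, and the factor `D` acts as a quantum determinant of
  -- `s`.
  s_ρ : ∀ l m, ρ l m • D = ∑ j, ∑ n, ρ j n • (s j l ∘ₗ s n m)
  map_π_mem : ∀ x ∈ S, TensorProduct.map π π x ∈ R
  map_incl_mem : ∀ r ∈ R, TensorProduct.map incl incl r ∈ S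
  comm_mem : ∀ j a, Y j ⊗ₜ[k] incl a - ∑ l, incl (s j l a) ⊗ₜ[k] Y l ∈ S
  rel_mem : ∑ j, ∑ l, ρ j l • (Y j ⊗ₜ[k] Y l) ∈ S
  -- The elements of `S` above bound `perp S` from above, which gives independence of the
  -- coordinates. The elements of `perp S` below bound it from below, which gives spanning.
  comm_perp : ∀ (f : Module.Dual k V) l,
    (f ∘ₗ π) ⊗ₜ[k] η l + ∑ j, η j ⊗ₜ[k] (f ∘ₗ s j l ∘ₗ π) ∈ perp S
  rel_perp : ∀ l m, η l ⊗ₜ[k] η m - ρ l m • (η 1 ⊗ₜ[k] η 0) ∈ perp S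

namespace DualExtension

variable {k : Type u} [Field k] {V : Type v} [AddCommGroup V] [Module k V]
  {W : Type w} [AddCommGroup W] [Module k W]
  {R : Submodule k (V ⊗[k] V)} {S : Submodule k (W ⊗[k] W)} (E : DualExtension R S)

/-- Expand the second `D` as `∑ ρ_{tm} s_{t1} s_{m0}`, shift `ρ_{tm}` to the first factor and expand
`ρ_{tm} D` by `s_ρ`. The result is `∑ ρ_{jn} (∑_t s_{jt} ⊗ s_{t1}) (∑_m s_{nm} ⊗ s_{m0})`, and both
inner sums preserve `R`. -/
theorem map_D_mem (r : V ⊗[k] V) (hr : r ∈ R) : TensorProduct.map E.D E.D r ∈ R := by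
  have hD : E.D = ∑ j, ∑ n, E.ρ j n • (E.s j 1 ∘ₗ E.s n 0) := by
    rw [← E.s_ρ, E.ρ_one_zero, one_smul]
  have key : TensorProduct.map E.D E.D r = ∑ j, ∑ n, E.ρ j n •
      ∑ t, TensorProduct.map (E.s j t) (E.s t 1)
        (∑ m, TensorProduct.map (E.s n m) (E.s m 0) r) := by
    have h1 : TensorProduct.map E.D E.D r = ∑ t, ∑ m,
        TensorProduct.map (∑ j, ∑ n, E.ρ j n • (E.s j t ∘ₗ E.s n m)) (E.s t 1 ∘ₗ E.s m 0) r := by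
      simp only [← E.s_ρ, TensorProduct.map_smul_left, ← TensorProduct.map_smul_right]
      conv_lhs => enter [1, 2]; rw [hD]
      simp only [← TensorProduct.mapBilinear_apply, map_sum, LinearMap.sum_apply]
    rw [h1]
    simp only [← TensorProduct.mapBilinear_apply, map_sum, map_smul, LinearMap.sum_apply,
      LinearMap.smul_apply]
    simp only [TensorProduct.mapBilinear_apply, TensorProduct.map_comp, LinearMap.comp_apply,
      Fin.sum_univ_two, smul_add]
    abel
  rw [key]
  exact sum_mem fun j _ => sum_mem fun n _ => R.smul_mem _
    (E.s_mem _ (E.s_mem _ hr _ _) _ _)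

/-- The inclusion `T(V*) / ⟨R^⊥⟩ → T(W*) / ⟨S^⊥⟩`. -/
noncomputable def φ : Quad (perp R) →ₐ[k] Quad (perp S) :=
  dualHom R S E.π E.map_π_mem

theorem φ_ι (f : Module.Dual k V) : E.φ (Quad.ι _ f) = Quad.ι _ (f ∘ₗ E.π) :=
  dualHom_ι ..

/-- The generators `y_j` dual to the `Y_j`. -/
noncomputable def y (j : Fin 2) : Quad (perp S) := Quad.ι _ (E.η j)

/-- The generator `y₁ y₀` of the part of degree two in the `y_j`. -/
noncomputable def z : Quad (perp S) := E.y 1 * E.y 0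

theorem y_mul_y (l m : Fin 2) : E.y l * E.y m = E.ρ l m • E.z := by
  have h := Quad.mulTensor_ι _ _ (E.rel_perp l m)
  rw [map_sub, map_smul, mulTensor_tmul, mulTensor_tmul, sub_eq_zero] at h
  exact h

/-- Every product of three `y`'s reduces to a multiple of `y₁ y₁ y₀`, and `y₁ y₁ = 0` because `ρ 1 1
= 0`. -/
theorem y_mul_z (l : Fin 2) : E.y l * E.z = 0 := by
  rw [z, ← mul_assoc, y_mul_y, smul_mul_assoc, z, mul_assoc, y_mul_y, mul_smul_comm, z,
    ← mul_assoc, y_mul_y, E.ρ_one_one]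
  simp

theorem ι_mul_y (f : Module.Dual k V) (l : Fin 2) :
    E.φ (Quad.ι _ f) * E.y l = -∑ j, E.y j * E.φ (Quad.ι _ (f ∘ₗ E.s j l)) := by
  have h := Quad.mulTensor_ι _ _ (E.comm_perp f l)
  rw [map_add, map_sum, mulTensor_tmul] at h
  simp only [mulTensor_tmul] at h
  simp only [φ_ι]
  exact eq_neg_of_add_eq_zero_left h

theorem ι_eq (ξ : Module.Dual k W) : Quad.ι (perp S) ξ =
    E.φ (Quad.ι _ (ξ ∘ₗ E.incl)) + ∑ j, ξ (E.Y j) • E.y j := by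
  have h : ξ = (ξ ∘ₗ E.incl) ∘ₗ E.π + ∑ j, ξ (E.Y j) • E.η j := by
    ext x
    conv_lhs => rw [E.decomp x]
    simp [mul_comm]
  conv_lhs => rw [h]
  simp [φ_ι, y]

/-- The action of `T(V*) / ⟨R^⊥⟩` on the span of the `y_j`. -/
noncomputable def Φ : Quad (perp R) →ₐ[k] Matrix (Fin 2) (Fin 2) (Quad (perp R)) :=
  dualMatrixHom R E.s E.s_mem

theorem Φ_ι (f : Module.Dual k V) (j l : Fin 2) :
    E.Φ (Quad.ι _ f) j l = -Quad.ι _ (f ∘ₗ E.s j l) :=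
  dualMatrixHom_ι ..

/-- The action of `T(V*) / ⟨R^⊥⟩` on the span of `z`. -/
noncomputable def Δ : Quad (perp R) →ₐ[k] Quad (perp R) :=
  dualHom R R E.D E.map_D_mem

theorem Δ_ι (f : Module.Dual k V) : E.Δ (Quad.ι _ f) = Quad.ι _ (f ∘ₗ E.D) :=
  dualHom_ι ..

/-- Coordinates with respect to `1, y₀, y₁, z`. -/
abbrev Coord (R : Submodule k (V ⊗[k] V)) : Type _ :=
  Quad (perp R) × (Fin 2 → Quad (perp R)) × Quad (perp R)

/-- The block-diagonal action of `T(V*) / ⟨R^⊥⟩` on the coordinates. -/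
noncomputable def diag : Quad (perp R) →ₐ[k] Module.End k (Coord R) :=
  AlgHom.ofLinearMap
    (LinearMap.mk₂ k (fun a (x : Coord R) => (a * x.1, (E.Φ a).mulVec x.2.1, E.Δ a * x.2.2))
      (by intros; simp [add_mul, Matrix.add_mulVec])
      (by intros; simp [Matrix.smul_mulVec])
      (by intros; simp [mul_add, Matrix.mulVec_add])
      (by intros; simp [Matrix.mulVec_smul]))
    (LinearMap.ext fun x => by
      change (1 * x.1, (E.Φ 1).mulVec x.2.1, E.Δ 1 * x.2.2) = x
      rw [map_one, map_one, one_mul, Matrix.one_mulVec, one_mul])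
    (fun a b => LinearMap.ext fun x => by
      change (a * b * x.1, (E.Φ (a * b)).mulVec x.2.1, E.Δ (a * b) * x.2.2)
        = (a * (b * x.1), (E.Φ a).mulVec ((E.Φ b).mulVec x.2.1), E.Δ a * (E.Δ b * x.2.2))
      rw [map_mul, map_mul, Matrix.mulVec_mulVec, mul_assoc, mul_assoc])

theorem diag_apply (a : Quad (perp R)) (x : Coord R) :
    E.diag a x = (a * x.1, (E.Φ a).mulVec x.2.1, E.Δ a * x.2.2) := rfl

/-- The action of `y_j` on the coordinates. -/
noncomputable def shift (j : Fin 2) : Module.End k (Coord R) where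
  toFun x := (0, Pi.single j x.1, ∑ m, E.ρ j m • x.2.1 m)
  map_add' x x' := by simp [Pi.single_add, Finset.sum_add_distrib]
  map_smul' c x := by simp [Pi.single_smul, smul_comm c]

theorem shift_apply (j : Fin 2) (x : Coord R) :
    E.shift j x = (0, Pi.single j x.1, ∑ m, E.ρ j m • x.2.1 m) := rfl

theorem shift_mul_shift (l m : Fin 2) :
    E.shift l * E.shift m = E.ρ l m • (E.shift 1 * E.shift 0) := by
  refine LinearMap.ext fun x => ?_
  simp [shift_apply, E.ρ_one_zero, Pi.single_apply]

/-- The rule `f y_l = -∑ y_j (f ∘ s_{jl})` for the operators on coordinates. The middle coordinates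
reproduce the definition of `Φ`. The last one is the determinant identity `s_ρ`, the two signs from
`Φ` cancelling in `Δ`. -/
theorem diag_mul_shift (f : Module.Dual k V) (l : Fin 2) :
    E.diag (Quad.ι _ f) * E.shift l
      + ∑ j, E.shift j * E.diag (Quad.ι _ (f ∘ₗ E.s j l)) = 0 := by
  refine LinearMap.ext fun x => ?_
  obtain ⟨u, v, w⟩ := x
  have hD : ∀ m, E.ρ l m • Quad.ι (perp R) (f ∘ₗ E.D)
      = ∑ j, ∑ n, E.ρ j n • Quad.ι (perp R) (f ∘ₗ E.s j l ∘ₗ E.s n m) := by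
    intro m
    have := congrArg (fun g => Quad.ι (perp R) (f ∘ₗ g)) (E.s_ρ l m)
    simpa [LinearMap.comp_smul, LinearMap.comp_add, Fin.sum_univ_two] using this
  have hD0 := congrArg (· * v 0) (hD 0)
  have hD1 := congrArg (· * v 1) (hD 1)
  simp only [Fin.sum_univ_two, add_mul, smul_mul_assoc] at hD0 hD1
  refine Prod.ext ?_ (Prod.ext ?_ ?_)
  · simp [shift_apply, diag_apply]
  · ext n
    fin_cases n <;> simp [shift_apply, diag_apply, Φ_ι]
  · simp only [shift_apply, diag_apply, Module.End.mul_apply, LinearMap.add_apply,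
      Matrix.mulVec, dotProduct, Fin.sum_univ_two, Φ_ι, Δ_ι,
      Prod.snd_add, mul_add, mul_smul_comm, hD0, hD1, Prod.snd_zero, LinearMap.zero_apply,
      neg_mul, smul_add, smul_neg, LinearMap.comp_assoc]
    abel

/-- The generators of `T(W*) / ⟨S^⊥⟩` acting on the coordinates. -/
noncomputable def genAction : Module.Dual k W →ₗ[k] Module.End k (Coord R) :=
  E.diag.toLinearMap ∘ₗ Quad.ι (perp R) ∘ₗ E.incl.dualMap
    + ∑ j, (Module.Dual.eval k W (E.Y j)).smulRight (E.shift j)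

theorem genAction_apply (ξ : Module.Dual k W) : E.genAction ξ =
    E.diag (Quad.ι _ (ξ ∘ₗ E.incl)) + ∑ j, ξ (E.Y j) • E.shift j := by
  simp [genAction]
  rfl

theorem genAction_comp_π (f : Module.Dual k V) :
    E.genAction (f ∘ₗ E.π) = E.diag (Quad.ι _ f) := by
  rw [genAction_apply]
  have : (f ∘ₗ E.π) ∘ₗ E.incl = f := by ext a; simp [E.π_incl]
  simp [this, E.π_Y]

theorem genAction_η (j : Fin 2) : E.genAction (E.η j) = E.shift j := by
  rw [genAction_apply]
  have : E.η j ∘ₗ E.incl = 0 := by ext a; simp [E.η_incl]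
  simp [this, E.η_Y]

/-- Every element of `W* ⊗ W*` in terms of `W* = V* ⊕ k η₀ ⊕ k η₁`. -/
theorem exists_tensor_decomp (r : Module.Dual k W ⊗[k] Module.Dual k W) :
    ∃ (r₀ : Module.Dual k V ⊗[k] Module.Dual k V) (f g : Fin 2 → Module.Dual k V)
      (c : Fin 2 → Fin 2 → k),
      r = TensorProduct.map E.π.dualMap E.π.dualMap r₀ + ∑ l, (f l ∘ₗ E.π) ⊗ₜ[k] E.η l
        + ∑ j, E.η j ⊗ₜ[k] (g j ∘ₗ E.π) + ∑ j, ∑ l, c j l • (E.η j ⊗ₜ[k] E.η l) := by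
  have hξ : ∀ ξ : Module.Dual k W, ξ = (ξ ∘ₗ E.incl) ∘ₗ E.π + ∑ j, ξ (E.Y j) • E.η j := by
    intro ξ
    ext x
    conv_lhs => rw [E.decomp x]
    simp [mul_comm]
  induction r using TensorProduct.induction_on with
  | zero => exact ⟨0, 0, 0, 0, by simp⟩
  | add x y hx hy =>
    obtain ⟨r, f, g, c, hx⟩ := hx
    obtain ⟨r', f', g', c', hy⟩ := hy
    refine ⟨r + r', f + f', g + g', c + c', ?_⟩
    rw [hx, hy]
    simp only [map_add, Pi.add_apply, LinearMap.add_comp, TensorProduct.add_tmul,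
      TensorProduct.tmul_add, Finset.sum_add_distrib, add_smul]
    abel
  | tmul ξ ξ' =>
    refine ⟨(ξ ∘ₗ E.incl) ⊗ₜ (ξ' ∘ₗ E.incl), fun l => ξ' (E.Y l) • (ξ ∘ₗ E.incl),
      fun l => ξ (E.Y l) • (ξ' ∘ₗ E.incl), fun j l => ξ (E.Y j) * ξ' (E.Y l), ?_⟩
    conv_lhs => rw [hξ ξ, hξ ξ']
    simp only [TensorProduct.map_tmul, Fin.sum_univ_two, TensorProduct.add_tmul,
      TensorProduct.tmul_add, TensorProduct.tmul_smul, ← TensorProduct.smul_tmul',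
      LinearMap.smul_comp, smul_add, mul_smul, LinearMap.dualMap_apply']
    rw [smul_comm (ξ' (E.Y 0)), smul_comm (ξ' (E.Y 0)), smul_comm (ξ' (E.Y 1)),
      smul_comm (ξ' (E.Y 1))]
    abel

/-- Split `r` into blocks along `W* = V* ⊕ k η₀ ⊕ k η₁` and pair it with the three known kinds of
elements of `S`. This puts the `V* ⊗ V*` block in `perp R`, expresses the block `η ⊗ V*` through `V*
⊗ η`, and makes the `η ⊗ η` block orthogonal to `ρ`. Each of these conditions annihilates the
corresponding operators. -/
theorem mulTensor_genAction (r : Module.Dual k W ⊗[k] Module.Dual k W) (hr : r ∈ perp S) :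
    mulTensor E.genAction r = 0 := by
  obtain ⟨r₀, f, g, c, rfl⟩ := E.exists_tensor_decomp r
  rw [mem_perp] at hr
  have h0 : r₀ ∈ perp R := by
    rw [mem_perp]
    intro t ht
    have h := hr _ (E.map_incl_mem t ht)
    rw [← dualDistrib_map_dualMap] at h
    have e1 : E.incl.dualMap ∘ₗ E.π.dualMap = LinearMap.id := by
      ext f a
      simp [E.π_incl]
    have e2 : ∀ f : Module.Dual k V, E.incl.dualMap (f ∘ₗ E.π) = f := by
      intro f
      ext a
      simp [E.π_incl]
    have e3 : ∀ j, E.incl.dualMap (E.η j) = 0 := by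
      intro j
      ext a
      simp [E.η_incl]
    simpa [← LinearMap.comp_apply, ← TensorProduct.map_comp, e1, e3] using h
  have hg : ∀ j, g j = ∑ l, f l ∘ₗ E.s j l := by
    intro j
    ext a
    have h := hr _ (E.comm_mem j a)
    have e : ∀ (x y : W), TensorProduct.dualDistrib k W W
        (TensorProduct.map E.π.dualMap E.π.dualMap r₀) (x ⊗ₜ y)
        = TensorProduct.dualDistrib k V V r₀ (E.π x ⊗ₜ E.π y) := by
      intro x y
      rw [dualDistrib_map_dualMap, TensorProduct.map_tmul]
    simp [e, E.π_incl, E.η_incl, E.η_Y, E.π_Y, Fin.sum_univ_two] at h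
    fin_cases j <;> simp [Fin.sum_univ_two] at h ⊢ <;> linear_combination h
  have hc : ∑ j, ∑ l, E.ρ j l * c j l = 0 := by
    have h := hr _ E.rel_mem
    have e : ∀ (x y : W), TensorProduct.dualDistrib k W W
        (TensorProduct.map E.π.dualMap E.π.dualMap r₀) (x ⊗ₜ y)
        = TensorProduct.dualDistrib k V V r₀ (E.π x ⊗ₜ E.π y) := by
      intro x y
      rw [dualDistrib_map_dualMap, TensorProduct.map_tmul]
    simp [e, E.η_Y, E.π_Y, Fin.sum_univ_two] at h
    simp [Fin.sum_univ_two]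
    linear_combination h
  have m0 : mulTensor E.genAction (TensorProduct.map E.π.dualMap E.π.dualMap r₀) = 0 := by
    have e : E.genAction ∘ₗ E.π.dualMap = E.diag.toLinearMap ∘ₗ Quad.ι (perp R) := by
      ext1 f
      exact E.genAction_comp_π f
    rw [mulTensor_comp_map, e]
    change mulTensor _ r₀ = 0
    rw [mulTensor_algHom_comp, Quad.mulTensor_ι _ _ h0, map_zero]
  have m1 : ∀ l, E.diag (Quad.ι _ (f l)) * E.shift l =
      - ∑ j, E.shift j * E.diag (Quad.ι _ (f l ∘ₗ E.s j l)) :=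
    fun l => eq_neg_of_add_eq_zero_left (E.diag_mul_shift (f l) l)
  simp only [map_add, map_sum, map_smul, m0, mulTensor_tmul, genAction_η, genAction_comp_π, m1, hg]
  have m2 : ∑ j, ∑ l, c j l • (E.shift j * E.shift l) = 0 := by
    have h : ∀ j l, c j l • (E.shift j * E.shift l)
        = (E.ρ j l * c j l) • (E.shift 1 * E.shift 0) := by
      intro j l
      rw [shift_mul_shift, smul_smul, mul_comm]
    simp only [h, ← Finset.sum_smul, hc, zero_smul]
  rw [m2]
  simp only [Fin.sum_univ_two, mul_add]
  abel

/-- The action of `T(W*) / ⟨S^⊥⟩` on the coordinates. -/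
noncomputable def action : Quad (perp S) →ₐ[k] Module.End k (Coord R) :=
  Quad.lift (perp S) E.genAction E.mulTensor_genAction

theorem action_ι (ξ : Module.Dual k W) : E.action (Quad.ι _ ξ) = E.genAction ξ :=
  Quad.lift_ι ..

theorem action_y (j : Fin 2) : E.action (E.y j) = E.shift j := by
  rw [y, action_ι, genAction_η]

theorem action_φ (a : Quad (perp R)) : E.action (E.φ a) = E.diag a := by
  have : E.action.comp E.φ = E.diag := Quad.algHom_ext fun f => by
    rw [AlgHom.comp_apply, φ_ι, action_ι, genAction_comp_π]
  rw [← this]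
  rfl

/-- The element with given right coordinates. -/
noncomputable def θ (x : Coord R) : Quad (perp S) :=
  E.φ x.1 + ∑ l, E.y l * E.φ (x.2.1 l) + E.z * E.φ x.2.2

/-- The action was modelled on left multiplication, so it suffices to compare the two on generators,
where the rules for `φ(f) y_l`, `y_l y_m` and `y_l z` apply. -/
theorem θ_action (b : Quad (perp S)) : ∀ x, E.θ (E.action b x) = b * E.θ x := by
  have hy : ∀ j x, E.θ (E.shift j x) = E.y j * E.θ x := by
    intro j x
    simp only [θ, shift_apply, mul_add, Finset.mul_sum, ← mul_assoc, y_mul_y, y_mul_z]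
    fin_cases j <;> simp [Fin.sum_univ_two, mul_add]
  have hf : ∀ f x, E.θ (E.diag (Quad.ι _ f) x) = E.φ (Quad.ι _ f) * E.θ x := by
    intro f x
    -- Moving `f` past `y₁` and then `y₀` produces two signs, which cancel, and the terms `y_j y_n =
    -- ρ_{jn} z` collect into `D`.
    have hz : E.φ (Quad.ι _ f) * E.z = E.z * E.φ (Quad.ι _ (f ∘ₗ E.D)) := by
      have hD : E.D = ∑ j, ∑ n, E.ρ j n • (E.s j 1 ∘ₗ E.s n 0) := by
        rw [← E.s_ρ, E.ρ_one_zero, one_smul]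
      rw [z, ← mul_assoc, ι_mul_y, neg_mul, Finset.sum_mul]
      simp only [mul_assoc, ι_mul_y, hD]
      simp only [mul_neg, Finset.mul_sum, ← mul_assoc, y_mul_y, LinearMap.comp_assoc]
      simp [Fin.sum_univ_two, LinearMap.comp_add, LinearMap.comp_smul, mul_add, E.ρ_one_zero]
      abel
    simp only [θ, diag_apply, mul_add, ← mul_assoc, hz, Finset.mul_sum, ι_mul_y, Δ_ι, map_mul]
    congr 2
    simp only [Matrix.mulVec, dotProduct, Φ_ι, Fin.sum_univ_two, map_add, map_mul, map_neg,
      mul_add, neg_mul, mul_neg, add_mul, neg_add, mul_assoc]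
    abel
  induction b using Quad.induction_left with
  | one => simp
  | smul c a ha =>
    intro x
    have hθ : ∀ x, E.θ (c • x) = c • E.θ x := by
      intro x
      simp [θ]
    rw [map_smul, LinearMap.smul_apply, hθ, ha, smul_mul_assoc]
  | add a b ha hb =>
    intro x
    have hθ : ∀ x x', E.θ (x + x') = E.θ x + E.θ x' := by
      intro x x'
      simp [θ, mul_add]
      abel
    rw [map_add, LinearMap.add_apply, hθ, ha, hb, add_mul]
  | mul ξ a ha =>
    have hθ : ∀ x x', E.θ (x + x') = E.θ x + E.θ x' := by
      intro x x'
      simp [θ, mul_add]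
      abel
    have hc : ∀ (c : k) x, E.θ (c • x) = c • E.θ x := by
      intro c x
      simp [θ]
    intro x
    rw [map_mul, Module.End.mul_apply, mul_assoc, ← ha, action_ι, genAction_apply, E.ι_eq]
    simp [Fin.sum_univ_two, hθ, hc, hy, hf, add_mul]

theorem action_θ (x : Coord R) : E.action (E.θ x) (1, 0, 0) = x := by
  obtain ⟨a, v, c⟩ := x
  refine Prod.ext ?_ (Prod.ext ?_ ?_)
  · simp [θ, z, action_y, action_φ, diag_apply, shift_apply]
  · ext j
    fin_cases j <;> simp [θ, z, action_y, action_φ, diag_apply, shift_apply]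
  · simp [θ, z, action_y, action_φ, diag_apply, shift_apply, Pi.single_apply, E.ρ_one_zero]

/-- The inverse is `b ↦ b · (1, 0, 0)`: one composite is `action_θ`, the other is `θ_action`
together with `θ (1, 0, 0) = 1`. -/
theorem θ_bijective : Function.Bijective E.θ := by
  refine ⟨Function.LeftInverse.injective (g := fun b => E.action b (1, 0, 0)) E.action_θ, fun b => ⟨E.action b (1, 0, 0), ?_⟩⟩
  rw [θ_action]
  simp [θ]

theorem φ_injective : Function.Injective E.φ := by
  intro a b h
  have := E.θ_bijective.1 (a₁ := (a, 0, 0)) (a₂ := (b, 0, 0)) (by simp [θ, h])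
  exact congrArg Prod.fst this

end DualExtension

end DualExtension

/-! ### Inverting matrices of endomorphisms -/

section LinearAlgebra

variable {k : Type u} [Field k] {M : Type v} [AddCommGroup M] [Module k M]

/-- The inverse of a linear map that preserves a finite-dimensional subspace preserves it too. -/
theorem leftInverse_mem [FiniteDimensional k M] {e g : M →ₗ[k] M} (hge : ∀ x, g (e x) = x)
    {N : Submodule k M} (he : ∀ x ∈ N, e x ∈ N) (x : M) (hx : x ∈ N) : g x ∈ N := by
  have hinj : Function.Injective (e.restrict he) := by
    intro a b hab
    apply Subtype.ext
    have : e a = e b := congrArg Subtype.val hab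
    rw [← hge a, this, hge]
  obtain ⟨y, hy⟩ := LinearMap.injective_iff_surjective.1 hinj ⟨x, hx⟩
  have : e y = x := congrArg Subtype.val hy
  rw [← this, hge]
  exact y.2

/-- A matrix of endomorphisms that is surjective on columns has a two-sided inverse. -/
theorem exists_matrix_inverse [FiniteDimensional k M] (s : Fin 2 → Fin 2 → M →ₗ[k] M)
    (h : ∀ l a, ∃ u : Fin 2 → M, ∀ m, ∑ j, s j m (u j) = if m = l then a else 0) :
    ∃ t : Fin 2 → Fin 2 → M →ₗ[k] M,
      (∀ l m, ∑ j, s j l ∘ₗ t m j = if l = m then LinearMap.id else 0) ∧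
      (∀ i j, ∑ l, t l j ∘ₗ s i l = if i = j then LinearMap.id else 0) := by
  -- The transposed matrix acts here: the sum runs over the first index of `s`. This is why the
  -- inverse `t` has its indices reversed.
  let F : (Fin 2 → M) →ₗ[k] (Fin 2 → M) :=
    LinearMap.pi fun l => ∑ j, s j l ∘ₗ LinearMap.proj j
  have hF : ∀ u l, F u l = ∑ j, s j l (u j) := fun u l => by simp [F]
  have hsurj : Function.Surjective F := by
    intro v
    choose u hu using h
    refine ⟨u 0 (v 0) + u 1 (v 1), ?_⟩
    ext l
    have h0 := hu 0 (v 0) l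
    have h1 := hu 1 (v 1) l
    rw [map_add, Pi.add_apply, hF, hF, h0, h1]
    fin_cases l <;> simp
  let e := LinearEquiv.ofBijective F ⟨LinearMap.injective_iff_surjective.2 hsurj, hsurj⟩
  have he : ∀ u, e u = F u := fun _ => rfl
  refine ⟨fun m j => LinearMap.proj j ∘ₗ e.symm.toLinearMap ∘ₗ LinearMap.single k (fun _ : Fin 2 => M) m, ?_, ?_⟩
  · intro l m
    ext a
    have h1 := congrFun (e.apply_symm_apply (Pi.single m a)) l
    rw [he, hF] at h1
    simp only [LinearMap.sum_apply, LinearMap.comp_apply, LinearMap.proj_apply,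
      LinearEquiv.coe_coe, LinearMap.single_apply]
    rw [h1]
    by_cases hlm : l = m
    · subst hlm; simp
    · simp [hlm]
  · intro i j
    ext a
    have h1 : e (Pi.single i a) = ∑ l, Pi.single l (s i l a) := by
      ext m
      rw [he, hF]
      fin_cases i <;> fin_cases m <;> simp
    have h2 := e.symm_apply_apply (Pi.single i a)
    rw [h1, map_sum] at h2
    have h3 := congrFun h2 j
    simp only [Finset.sum_apply] at h3
    simp only [LinearMap.sum_apply, LinearMap.comp_apply, LinearMap.proj_apply,
      LinearEquiv.coe_coe, LinearMap.single_apply]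
    rw [h3]
    by_cases hij : i = j
    · subst hij; simp
    · simp [hij, Ne.symm hij]

/-- The inverse of a matrix of endomorphisms which respects `R` respects `R`. -/
theorem sum_map_inverse_mem [FiniteDimensional k M] {R : Submodule k (M ⊗[k] M)}
    {s t : Fin 2 → Fin 2 → M →ₗ[k] M}
    (hs : ∀ r ∈ R, ∀ j l, ∑ m, TensorProduct.map (s j m) (s m l) r ∈ R)
    (ht : ∀ i j, ∑ l, t l j ∘ₗ s i l = if i = j then LinearMap.id else 0)
    (r : M ⊗[k] M) (hr : r ∈ R) (j l : Fin 2) :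
    ∑ m, TensorProduct.map (t m j) (t l m) r ∈ R := by
  let e : (Fin 2 → M ⊗[k] M) →ₗ[k] (Fin 2 → M ⊗[k] M) :=
    LinearMap.pi fun l => ∑ j, ∑ m, TensorProduct.map (s j m) (s m l) ∘ₗ LinearMap.proj j
  let g : (Fin 2 → M ⊗[k] M) →ₗ[k] (Fin 2 → M ⊗[k] M) :=
    LinearMap.pi fun j => ∑ l, ∑ m, TensorProduct.map (t m j) (t l m) ∘ₗ LinearMap.proj l
  have he : ∀ x l, e x l = ∑ j, ∑ m, TensorProduct.map (s j m) (s m l) (x j) :=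
    fun x l => by simp [e]
  have hg : ∀ x j, g x j = ∑ l, ∑ m, TensorProduct.map (t m j) (t l m) (x l) :=
    fun x l => by simp [g]
  have hge : ∀ x, g (e x) = x := by
    intro x
    ext1 j
    have h1 : g (e x) j = ∑ i, ∑ m, ∑ n,
        TensorProduct.map (t m j ∘ₗ s i n) (∑ l, t l m ∘ₗ s n l) (x i) := by
      rw [hg]
      simp only [he, Fin.sum_univ_two, TensorProduct.map_add_right, TensorProduct.map_comp,
        LinearMap.add_apply, LinearMap.comp_apply, map_add]
      abel
    -- The right tensor factor collapses to `n = m`, after which the left factor sums to the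
    -- identity or zero.
    have h2 : ∀ i, ∑ m, ∑ n, TensorProduct.map (t m j ∘ₗ s i n) (∑ l, t l m ∘ₗ s n l) (x i)
        = TensorProduct.map (∑ m, t m j ∘ₗ s i m) LinearMap.id (x i) := by
      intro i
      simp only [ht]
      rw [← ht i j, Fin.sum_univ_two (fun m => t m j ∘ₗ s i m), TensorProduct.map_add_left]
      simp [Fin.sum_univ_two]
    rw [h1, Finset.sum_congr rfl fun i _ => h2 i]
    simp only [ht]
    fin_cases j <;> simp [Fin.sum_univ_two]
  -- `e` preserves the pairs with both entries in `R`, hence by finite dimension so does its inverse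
  -- `g`. The pair with single entry `r` in place `l` isolates the sum wanted.
  have hmem := leftInverse_mem hge (N := Submodule.pi Set.univ fun _ => R)
    (fun x hx l _ => by
      rw [he]
      refine sum_mem fun j _ => hs _ (hx j trivial) j l)
    (Pi.single l r) (fun m _ => by
      by_cases h : m = l
      · subst h; simpa using hr
      · simp [h])
  have h3 := hmem j trivial
  rw [hg] at h3
  fin_cases l <;> simpa [Fin.sum_univ_two] using h3

end LinearAlgebra

/-! ### The dual of a double extension is free as a left module -/

namespace DualExtension

variable {k : Type u} [Field k] {V : Type v} [AddCommGroup V] [Module k V]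
  {W : Type w} [AddCommGroup W] [Module k W]
  {R : Submodule k (V ⊗[k] V)} {S : Submodule k (W ⊗[k] W)} (E : DualExtension R S)

/-- The determinant `D` of an invertible matrix is invertible; its inverse `T` is the analogous
determinant of `t`. In `T ∘ D` the identity `s_ρ` lets the `t`'s cancel the `s`'s one after the
other, leaving `ρ 1 0 = 1`. -/
theorem Δ_bijective [FiniteDimensional k V] {t : Fin 2 → Fin 2 → V →ₗ[k] V}
    (ht : ∀ i j, ∑ l, t l j ∘ₗ E.s i l = if i = j then LinearMap.id else 0) :
    Function.Bijective E.Δ := by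
  let T : V →ₗ[k] V := ∑ m, ∑ l, E.ρ m l • (t l 0 ∘ₗ t m 1)
  have hTD : T ∘ₗ E.D = LinearMap.id := by
    have h1 : T ∘ₗ E.D = ∑ l, ∑ j, ∑ n, E.ρ j n •
        (t l 0 ∘ₗ (∑ m, t m 1 ∘ₗ E.s j m) ∘ₗ E.s n l) := by
      have h2 : T ∘ₗ E.D = ∑ m, ∑ l, t l 0 ∘ₗ t m 1 ∘ₗ (E.ρ m l • E.D) := by
        simp only [T, Fin.sum_univ_two, LinearMap.add_comp, LinearMap.smul_comp,
          LinearMap.comp_smul, LinearMap.comp_assoc]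
      rw [h2]
      simp only [E.s_ρ, Fin.sum_univ_two, LinearMap.comp_add, LinearMap.add_comp,
        LinearMap.comp_smul, LinearMap.comp_assoc, smul_add]
      abel
    rw [h1]
    simp only [ht]
    have h00 := ht 0 0
    simp only [Fin.sum_univ_two, if_true] at h00
    simp only [Fin.sum_univ_two, E.ρ_one_zero, E.ρ_one_one]
    simpa using h00
  have hDT : E.D ∘ₗ T = LinearMap.id := (LinearMap.comp_eq_id_comm k V).1 hTD
  have hT : ∀ r ∈ R, TensorProduct.map T T r ∈ R :=
    leftInverse_mem (fun x => by
      rw [← LinearMap.comp_apply, ← TensorProduct.map_comp, hTD, TensorProduct.map_id]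
      rfl) E.map_D_mem
  have h1 : E.Δ.comp (dualHom R R T hT) = AlgHom.id k _ := Quad.algHom_ext fun f => by
    rw [AlgHom.comp_apply, dualHom_ι, Δ_ι, LinearMap.comp_assoc, hTD]
    rfl
  have h2 : (dualHom R R T hT).comp E.Δ = AlgHom.id k _ := Quad.algHom_ext fun f => by
    rw [AlgHom.comp_apply, Δ_ι, dualHom_ι, LinearMap.comp_assoc, hDT]
    rfl
  exact ⟨Function.LeftInverse.injective (DFunLike.congr_fun h2),
    Function.RightInverse.surjective (DFunLike.congr_fun h1)⟩

/-- By `φ_mul_y`, this map turns the left coefficients of a combination of the `y_l` into its right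
coefficients. -/
theorem Φ_column_bijective [FiniteDimensional k V] {t : Fin 2 → Fin 2 → V →ₗ[k] V}
    (ht' : ∀ l m, ∑ j, E.s j l ∘ₗ t m j = if l = m then LinearMap.id else 0)
    (ht : ∀ i j, ∑ l, t l j ∘ₗ E.s i l = if i = j then LinearMap.id else 0) :
    Function.Bijective
      (fun (v : Fin 2 → Quad (perp R)) (j : Fin 2) => ∑ l, E.Φ (v l) j l) := by
  -- `Ψ` encodes the opposite rule `y_j a = ∑ Ψ(a)_{jl} y_l`. The identities `h1` and `h2` say that
  -- moving `a` across and back changes nothing; on generators they are the inverse relations of `s`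
  -- and `t`.
  let Ψ := dualMatrixHom R (fun j l => t l j) (sum_map_inverse_mem E.s_mem ht)
  have hΨ : ∀ f j l, Ψ (Quad.ι _ f) j l = -Quad.ι _ (f ∘ₗ t l j) := fun f j l =>
    dualMatrixHom_ι ..
  have h1 : ∀ a i j, ∑ l, E.Φ (Ψ a j l) i l = if i = j then a else 0 := by
    intro a
    induction a using Quad.induction_left with
    | one =>
      intro i j
      fin_cases i <;> fin_cases j <;> simp [Fin.sum_univ_two]
    | smul c a ha =>
      intro i j
      simp only [map_smul, Matrix.smul_apply, ← Finset.smul_sum, ha]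
      simp
    | add a b ha hb =>
      intro i j
      simp only [map_add, Matrix.add_apply, Finset.sum_add_distrib, ha, hb]
      split_ifs <;> simp
    | mul f a ha =>
      intro i j
      -- Multiplicativity of `Φ` and `Ψ` isolates the inner sum for `a`, to which the induction
      -- hypothesis applies, and then leaves the sum for the generator `f`.
      have e : ∑ l, E.Φ (Ψ (Quad.ι _ f * a) j l) i l = ∑ m, ∑ n,
          E.Φ (Ψ (Quad.ι _ f) j m) i n * ∑ l, E.Φ (Ψ a m l) n l := by
        simp only [map_mul, Matrix.mul_apply, Fin.sum_univ_two, map_add, Matrix.add_apply, mul_add]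
        abel
      have e2 : ∑ m, E.Φ (Ψ (Quad.ι _ f) j m) i m = if i = j then Quad.ι _ f else 0 := by
        have h3 := congrArg (fun g => Quad.ι (perp R) (f ∘ₗ g)) (ht i j)
        simp only [hΨ, map_neg, Matrix.neg_apply, Φ_ι, neg_neg]
        split_ifs at h3 ⊢ <;>
          simpa [LinearMap.comp_add, Fin.sum_univ_two, LinearMap.comp_assoc] using h3
      rw [e]
      simp only [ha]
      simp only [mul_ite, mul_zero, Finset.sum_ite_eq', Finset.mem_univ, if_true,
        ← Finset.sum_mul, e2, ite_mul, zero_mul]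
  have h2 : ∀ a l m, ∑ j, Ψ (E.Φ a j l) j m = if l = m then a else 0 := by
    intro a
    induction a using Quad.induction_left with
    | one =>
      intro i j
      fin_cases i <;> fin_cases j <;> simp [Fin.sum_univ_two]
    | smul c a ha =>
      intro i j
      simp only [map_smul, Matrix.smul_apply, ← Finset.smul_sum, ha]
      simp
    | add a b ha hb =>
      intro i j
      simp only [map_add, Matrix.add_apply, Finset.sum_add_distrib, ha, hb]
      split_ifs <;> simp
    | mul f a ha =>
      intro l m
      have e : ∑ j, Ψ (E.Φ (Quad.ι _ f * a) j l) j m = ∑ i, ∑ n,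
          (∑ j, Ψ (E.Φ (Quad.ι _ f) j i) j n) * Ψ (E.Φ a i l) n m := by
        simp only [map_mul, Matrix.mul_apply, Fin.sum_univ_two, map_add, Matrix.add_apply, add_mul]
        abel
      have e2 : ∀ i n, ∑ j, Ψ (E.Φ (Quad.ι _ f) j i) j n
          = if i = n then Quad.ι _ f else 0 := by
        intro i n
        have h3 := congrArg (fun g => Quad.ι (perp R) (f ∘ₗ g)) (ht' i n)
        simp only [hΨ, map_neg, Matrix.neg_apply, Φ_ι, neg_neg]
        split_ifs at h3 ⊢ <;>
          simpa [LinearMap.comp_add, Fin.sum_univ_two, LinearMap.comp_assoc] using h3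
      rw [e]
      simp only [e2]
      simp only [ite_mul, zero_mul, Finset.sum_ite_eq, Finset.mem_univ, if_true,
        ← Finset.mul_sum, ha, mul_ite, mul_zero]
  refine Function.bijective_iff_has_inverse.2 ⟨fun v l => ∑ j, Ψ (v j) j l, ?_, ?_⟩
  · intro v
    ext m
    have e : ∑ j, Ψ (∑ l, E.Φ (v l) j l) j m = ∑ l, ∑ j, Ψ (E.Φ (v l) j l) j m := by
      simp only [map_sum, Matrix.sum_apply]
      exact Finset.sum_comm
    simp only [e, h2]
    simp
  · intro v
    ext i
    have e : ∑ l, E.Φ (∑ j, Ψ (v j) j l) i l = ∑ j, ∑ l, E.Φ (Ψ (v j) j l) i l := by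
      simp only [map_sum, Matrix.sum_apply]
      exact Finset.sum_comm
    simp only [e, h1]
    simp

theorem φ_mul_y (a : Quad (perp R)) (l : Fin 2) :
    E.φ a * E.y l = ∑ j, E.y j * E.φ (E.Φ a j l) := by
  have h := E.θ_action (E.φ a) (0, Pi.single l 1, 0)
  rw [action_φ, diag_apply] at h
  fin_cases l <;> simp [θ, Fin.sum_univ_two] at h ⊢ <;> exact h.symm

theorem φ_mul_z (a : Quad (perp R)) : E.φ a * E.z = E.z * E.φ (E.Δ a) := by
  have h := E.θ_action (E.φ a) (0, 0, 1)
  rw [action_φ, diag_apply] at h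
  simpa [θ] using h.symm

/-- The element with given left coordinates. -/
noncomputable def θLeft (x : Coord R) : Quad (perp S) :=
  E.φ x.1 + ∑ l, E.φ (x.2.1 l) * E.y l + E.φ x.2.2 * E.z

theorem θLeft_bijective [FiniteDimensional k V] {t : Fin 2 → Fin 2 → V →ₗ[k] V}
    (ht' : ∀ l m, ∑ j, E.s j l ∘ₗ t m j = if l = m then LinearMap.id else 0)
    (ht : ∀ i j, ∑ l, t l j ∘ₗ E.s i l = if i = j then LinearMap.id else 0) :
    Function.Bijective E.θLeft := by
  have h : E.θLeft = E.θ ∘ Prod.map id (Prod.map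
      (fun (v : Fin 2 → Quad (perp R)) (j : Fin 2) => ∑ l, E.Φ (v l) j l) E.Δ) := by
    ext x
    simp only [θLeft, θ, Function.comp_apply, Prod.map, id, φ_mul_z, φ_mul_y, map_sum,
      Finset.mul_sum]
    rw [Finset.sum_comm]
  rw [h]
  exact E.θ_bijective.comp (Function.bijective_id.prodMap
    ((E.Φ_column_bijective ht' ht).prodMap (E.Δ_bijective ht)))

/-- Regrouping four coordinates, with the last one rescaled. -/
theorem coord_bijective (R : Submodule k (V ⊗[k] V)) {c : k} (hc : c ≠ 0) :
    Function.Bijective (fun x : Fin 4 →₀ Quad (perp R) =>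
      ((x 0, ![x 1, x 2], c • x 3) : Coord R)) := by
  constructor
  · intro x x' h
    simp only [Prod.mk.injEq] at h
    obtain ⟨h0, h1, h2⟩ := h
    have h10 := congrFun h1 0
    have h11 := congrFun h1 1
    have h3 := smul_right_injective _ hc h2
    ext i
    fin_cases i
    · exact h0
    · exact h10
    · exact h11
    · exact h3
  · rintro ⟨a, v, b⟩
    refine ⟨Finsupp.equivFunOnFinite.symm ![a, v 0, v 1, c⁻¹ • b], ?_⟩
    refine Prod.ext rfl (Prod.ext ?_ ?_)
    · ext j
      fin_cases j <;> rfl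
    · exact smul_inv_smul₀ hc b

/-- Since `y₀ y₁ = ρ 0 1 • z`, the family differs from `1, y₀, y₁, z` by an invertible scalar. -/
theorem isRightBasis (h : E.ρ 0 1 ≠ 0) :
    IsRightBasis (E.φ : Quad (perp R) →+* Quad (perp S))
      ![1, E.y 0, E.y 1, E.y 0 * E.y 1] := by
  have e : (fun c : Fin 4 →₀ Quad (perp R) => c.sum fun j a =>
      (![1, E.y 0, E.y 1, E.y 0 * E.y 1] : Fin 4 → Quad (perp S)) j *
        (E.φ : Quad (perp R) →+* Quad (perp S)) a)
      = E.θ ∘ fun x => ((x 0, ![x 1, x 2], E.ρ 0 1 • x 3) : Coord R) := by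
    ext c
    rw [Finsupp.sum_fintype _ _ (by simp)]
    simp [Fin.sum_univ_four, θ, y_mul_y, add_assoc]
  rw [IsRightBasis, e]
  exact E.θ_bijective.comp (coord_bijective R h)

theorem isLeftBasis [FiniteDimensional k V] (h : E.ρ 0 1 ≠ 0)
    (hs : ∀ l a, ∃ u : Fin 2 → V, ∀ m, ∑ j, E.s j m (u j) = if m = l then a else 0) :
    IsLeftBasis (E.φ : Quad (perp R) →+* Quad (perp S))
      ![1, E.y 0, E.y 1, E.y 0 * E.y 1] := by
  obtain ⟨t, ht', ht⟩ := exists_matrix_inverse E.s hs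
  have e : (fun c : Fin 4 →₀ Quad (perp R) => c.sum fun j a =>
      (E.φ : Quad (perp R) →+* Quad (perp S)) a *
        (![1, E.y 0, E.y 1, E.y 0 * E.y 1] : Fin 4 → Quad (perp S)) j)
      = E.θLeft ∘ fun x => ((x 0, ![x 1, x 2], E.ρ 0 1 • x 3) : Coord R) := by
    ext c
    rw [Finsupp.sum_fintype _ _ (by simp)]
    simp [Fin.sum_univ_four, θLeft, y_mul_y, add_assoc]
  rw [IsLeftBasis, e]
  exact (E.θLeft_bijective ht' ht).comp (coord_bijective R h)

end DualExtension

/-! ### The linear data of a trimmed double Ore extension -/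

namespace IsTrimmedRightDoubleOre

variable {k : Type u} [Field k] {A : Type v} [Ring A] [Algebra k A]
  {B : Type w} [Ring B] [Algebra k B] {𝒜 : ℕ → Submodule k A} {ℬ : ℕ → Submodule k B}
  {i : A →ₐ[k] B} {y₁ y₂ : B} {p q : k} {σ : A → Matrix (Fin 2) (Fin 2) A}
  (hB : IsTrimmedRightDoubleOre 𝒜 ℬ i y₁ y₂ p q σ)

include hB

theorem comm (j : Fin 2) (a : A) :
    ![y₁, y₂] j * i a = i (σ a j 0) * y₁ + i (σ a j 1) * y₂ := by
  fin_cases j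
  · simpa using hB.rightDoubleOre.comm₁ a
  · simpa using hB.rightDoubleOre.comm₂ a

theorem rel : y₂ * y₁ = p • (y₁ * y₂) + q • (y₁ * y₁) := by
  simpa [pow_two] using hB.rightDoubleOre.relation

theorem eq_of_linear {a₀ a₁ a₂ b₀ b₁ b₂ : A}
    (h : i a₀ + i a₁ * y₁ + i a₂ * y₂ = i b₀ + i b₁ * y₁ + i b₂ * y₂) :
    a₀ = b₀ ∧ a₁ = b₁ ∧ a₂ = b₂ := by
  obtain ⟨P, -, hP⟩ := hB.exists_coeff
  have hP' : ∀ a₀ a₁ a₂, P (i a₀ + i a₁ * y₁ + i a₂ * y₂)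
      = Finsupp.single (0, 0) a₀ + Finsupp.single (1, 0) a₁ + Finsupp.single (0, 1) a₂ := by
    intro a₀ a₁ a₂
    rw [← hP, ← hP, ← hP]
    simp
  have h1 := congrArg P h
  rw [hP', hP'] at h1
  refine ⟨?_, ?_, ?_⟩
  · simpa using DFunLike.congr_fun h1 (0, 0)
  · simpa using DFunLike.congr_fun h1 (1, 0)
  · simpa using DFunLike.congr_fun h1 (0, 1)

theorem eq_of_sum_eq {a₁ a₂ b₁ b₂ : A}
    (h : i a₁ * y₁ + i a₂ * y₂ = i b₁ * y₁ + i b₂ * y₂) : a₁ = b₁ ∧ a₂ = b₂ :=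
  (hB.eq_of_linear (a₀ := 0) (b₀ := 0) (by simpa using h)).2

theorem eq_zero_of_quadratic {a b c : A}
    (h : i a * (y₁ * y₁) + i b * (y₁ * y₂) + i c * (y₂ * y₂) = 0) :
    a = 0 ∧ b = 0 ∧ c = 0 := by
  obtain ⟨P, -, hP⟩ := hB.exists_coeff
  have hP' : P (i a * (y₁ * y₁) + i b * (y₁ * y₂) + i c * (y₂ * y₂))
      = Finsupp.single (2, 0) a + Finsupp.single (1, 1) b + Finsupp.single (0, 2) c := by
    rw [← hP, ← hP, ← hP]
    simp [pow_two]
  rw [h, map_zero] at hP'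
  refine ⟨?_, ?_, ?_⟩
  · simpa using (DFunLike.congr_fun hP' (2, 0)).symm
  · simpa using (DFunLike.congr_fun hP' (1, 1)).symm
  · simpa using (DFunLike.congr_fun hP' (0, 2)).symm

theorem σ_add (a b : A) : σ (a + b) = σ a + σ b := by
  ext j l
  have h : i (σ (a + b) j 0) * y₁ + i (σ (a + b) j 1) * y₂
      = i (σ a j 0 + σ b j 0) * y₁ + i (σ a j 1 + σ b j 1) * y₂ := by
    rw [← hB.comm, map_add, mul_add, hB.comm, hB.comm, map_add, map_add, add_mul, add_mul]
    abel
  obtain ⟨h0, h1⟩ := hB.eq_of_sum_eq h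
  fin_cases l
  · exact h0
  · exact h1

theorem σ_smul (c : k) (a : A) : σ (c • a) = c • σ a := by
  ext j l
  have h : i (σ (c • a) j 0) * y₁ + i (σ (c • a) j 1) * y₂
      = i (c • σ a j 0) * y₁ + i (c • σ a j 1) * y₂ := by
    rw [← hB.comm, map_smul, mul_smul_comm, hB.comm, map_smul, map_smul, smul_add,
      smul_mul_assoc, smul_mul_assoc]
  obtain ⟨h0, h1⟩ := hB.eq_of_sum_eq h
  fin_cases l
  · exact h0
  · exact h1

/-- Compare the coefficients of `y₁` and `y₂` in `y_j (ab) = (y_j a) b`. -/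
theorem σ_mul (a b : A) : σ (a * b) = σ a * σ b := by
  ext j l
  have hc₁ : ∀ a, y₁ * i a = i (σ a 0 0) * y₁ + i (σ a 0 1) * y₂ := hB.comm 0
  have hc₂ : ∀ a, y₂ * i a = i (σ a 1 0) * y₁ + i (σ a 1 1) * y₂ := hB.comm 1
  have h : i (σ (a * b) j 0) * y₁ + i (σ (a * b) j 1) * y₂
      = i ((σ a * σ b) j 0) * y₁ + i ((σ a * σ b) j 1) * y₂ := by
    rw [← hB.comm, map_mul, ← mul_assoc, hB.comm, add_mul, mul_assoc, mul_assoc, hc₁, hc₂]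
    simp only [Matrix.mul_apply, Fin.sum_univ_two, map_add, map_mul, mul_add, add_mul, mul_assoc]
    abel
  obtain ⟨h0, h1⟩ := hB.eq_of_sum_eq h
  fin_cases l
  · exact h0
  · exact h1

/-- With `X_{lm} = ∑ ρ_{jn} σ_{jl} σ_{nm}` for the relation `ρ` between `y₁` and `y₂`, the matrix
`X` is proportional to `ρ`. -/
theorem σ_rel (a : A) (l m : Fin 2) :
    ∑ j, ∑ n, (!![-q, -p; 1, 0] : Matrix (Fin 2) (Fin 2) k) j n • σ (σ a n m) j l
      = (!![-q, -p; 1, 0] : Matrix (Fin 2) (Fin 2) k) l m •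
        ∑ j, ∑ n, (!![-q, -p; 1, 0] : Matrix (Fin 2) (Fin 2) k) j n • σ (σ a n 0) j 1 := by
  have hc₁ : ∀ a, y₁ * i a = i (σ a 0 0) * y₁ + i (σ a 0 1) * y₂ := hB.comm 0
  have hc₂ : ∀ a, y₂ * i a = i (σ a 1 0) * y₁ + i (σ a 1 1) * y₂ := hB.comm 1
  have hr : y₂ * y₁ = p • (y₁ * y₂) + q • (y₁ * y₁) := hB.rel
  let X : Fin 2 → Fin 2 → A := fun l m => σ (σ a 0 m) 1 l - p • σ (σ a 1 m) 0 l
    - q • σ (σ a 0 m) 0 l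
  have hX : ∀ l m, ∑ j, ∑ n, (!![-q, -p; 1, 0] : Matrix (Fin 2) (Fin 2) k) j n • σ (σ a n m) j l
      = X l m := by
    intro l m
    simp [Fin.sum_univ_two, X]
    abel
  have h21 : ∀ n j : Fin 2, ∀ b, ![y₁, y₂] j * (i b * ![y₁, y₂] n)
      = i (σ b j 0) * (y₁ * ![y₁, y₂] n) + i (σ b j 1) * (y₂ * ![y₁, y₂] n) := by
    intro n j b
    rw [← mul_assoc, hB.comm, add_mul, mul_assoc, mul_assoc]
  -- This is the zero element `(y₂ y₁ - p y₁ y₂ - q y₁²) a` with `a` moved to the left. Rewriting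
  -- `y₂ y₁` in the basis then expresses every `X l m` through `X 1 0`.
  have hq : i (X 0 0) * (y₁ * y₁) + i (X 0 1) * (y₁ * y₂) + i (X 1 0) * (y₂ * y₁)
      + i (X 1 1) * (y₂ * y₂) = 0 := by
    have h0 : (y₂ * y₁ - p • (y₁ * y₂) - q • (y₁ * y₁)) * i a = 0 := by
      rw [hr]
      simp
    have a11 := h21 0 0
    have a12 := h21 1 0
    have a21 := h21 0 1
    have a22 := h21 1 1
    simp only [Matrix.cons_val_zero, Matrix.cons_val_one] at a11 a12 a21 a22
    rw [sub_mul, sub_mul, smul_mul_assoc, smul_mul_assoc, mul_assoc, mul_assoc, mul_assoc,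
      hc₁, hc₂, mul_add, mul_add, mul_add, a11, a12, a11, a12, a21, a22] at h0
    rw [← h0]
    simp only [X, map_sub, map_smul, sub_mul, smul_mul_assoc, smul_add]
    abel
  have hq2 : i (X 0 0 + q • X 1 0) * (y₁ * y₁) + i (X 0 1 + p • X 1 0) * (y₁ * y₂)
      + i (X 1 1) * (y₂ * y₂) = 0 := by
    rw [← hq, hr]
    simp only [map_add, map_smul, add_mul, mul_add, smul_mul_assoc, mul_smul_comm]
    abel
  obtain ⟨h1, h2, h3⟩ := hB.eq_zero_of_quadratic hq2
  rw [hX, hX]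
  fin_cases l <;> fin_cases m
  · simpa using eq_neg_of_add_eq_zero_left h1
  · simpa using eq_neg_of_add_eq_zero_left h2
  · simp
  · simpa using h3

/-- On a quadratic relation of `B` all these coefficients vanish, so each of them provides bilinear
forms in `R_B^⊥`. -/
theorem exists_coeff_mul : ∃ P : B →+ (ℕ × ℕ →₀ A),
    ∀ (a b : A) (s t s' t' : k),
      P ((i a + s • y₁ + t • y₂) * (i b + s' • y₁ + t' • y₂)) =
        Finsupp.single (0, 0) (a * b)
        + Finsupp.single (1, 0) (s' • a + s • σ b 0 0 + t • σ b 1 0)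
        + Finsupp.single (0, 1) (t' • a + s • σ b 0 1 + t • σ b 1 1)
        + Finsupp.single (2, 0) (algebraMap k A (s * s' + q * (t * s')))
        + Finsupp.single (1, 1) (algebraMap k A (s * t' + p * (t * s')))
        + Finsupp.single (0, 2) (algebraMap k A (t * t')) := by
  obtain ⟨P, -, hP⟩ := hB.exists_coeff
  refine ⟨P, fun a b s t s' t' => ?_⟩
  have hc₁ : ∀ a, y₁ * i a = i (σ a 0 0) * y₁ + i (σ a 0 1) * y₂ := hB.comm 0
  have hc₂ : ∀ a, y₂ * i a = i (σ a 1 0) * y₁ + i (σ a 1 1) * y₂ := hB.comm 1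
  have sm : ∀ (c : k) (z : B), i (algebraMap k A c) * z = c • z := fun c z => by
    rw [AlgHom.commutes, Algebra.smul_def]
  rw [← hP, ← hP, ← hP, ← hP, ← hP, ← hP, ← map_add, ← map_add, ← map_add, ← map_add, ← map_add]
  congr 1
  simp only [sm, add_mul, mul_add, smul_mul_assoc, mul_smul_comm, hc₁, hc₂, hB.rel, map_mul,
    map_add, map_smul, smul_add, smul_smul, pow_two, pow_zero, pow_one, mul_one, one_mul]
  module

/-- The maps `σ_{jl}` as linear maps. -/
def σLin (j l : Fin 2) : A →ₗ[k] A where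
  toFun a := σ a j l
  map_add' a b := by rw [hB.σ_add]; rfl
  map_smul' c a := by rw [hB.σ_smul]; rfl

variable [GradedAlgebra 𝒜] [GradedAlgebra ℬ]

theorem decompose_map (a : A) (n : ℕ) :
    (DirectSum.decompose ℬ (i a) n : B) = i (DirectSum.decompose 𝒜 a n) := by
  induction a using DirectSum.Decomposition.inductionOn 𝒜 with
  | zero => simp
  | add a b ha hb => simp [DirectSum.decompose_add, ha, hb]
  | @homogeneous d a =>
    have hm : i a ∈ ℬ d := hB.map_mem d a a.2
    by_cases h : d = n
    · subst h
      rw [DirectSum.decompose_of_mem_same _ hm, DirectSum.decompose_of_mem_same _ a.2]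
    · rw [DirectSum.decompose_of_mem_ne _ hm h, DirectSum.decompose_of_mem_ne _ a.2 h, map_zero]

theorem decompose_map_mul (a : A) {y : B} (hy : y ∈ ℬ 1) :
    (DirectSum.decompose ℬ (i a * y) 2 : B) = i (DirectSum.decompose 𝒜 a 1) * y := by
  rw [← hB.decompose_map]
  exact DirectSum.coe_decompose_mul_add_of_right_mem ℬ (i := 1) hy

theorem decompose_mul_map (a : A) {y : B} (hy : y ∈ ℬ 1) :
    (DirectSum.decompose ℬ (y * i a) 2 : B) = y * i (DirectSum.decompose 𝒜 a 1) := by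
  rw [← hB.decompose_map]
  exact DirectSum.coe_decompose_mul_add_of_left_mem ℬ (j := 1) hy

omit [GradedAlgebra 𝒜] [GradedAlgebra ℬ] in
theorem y_mem (j : Fin 2) : ![y₁, y₂] j ∈ ℬ 1 := by
  fin_cases j
  · exact hB.y₁_mem
  · exact hB.y₂_mem

/-- As `y_j a` is homogeneous of degree two, taking its component of degree two replaces each
`σ_{jl}(a)` by its component of degree one without changing the sum. -/
theorem σ_mem (j l : Fin 2) (a : A) (ha : a ∈ 𝒜 1) : σ a j l ∈ 𝒜 1 := by
  have h := hB.decompose_mul_map a (hB.y_mem j)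
  rw [DirectSum.decompose_of_mem_same _ ha, hB.comm, DirectSum.decompose_add,
    DirectSum.add_apply, Submodule.coe_add, hB.decompose_map_mul _ hB.y₁_mem,
    hB.decompose_map_mul _ hB.y₂_mem] at h
  obtain ⟨h0, h1⟩ := hB.eq_of_sum_eq h
  fin_cases l
  · exact h0 ▸ SetLike.coe_mem _
  · exact h1 ▸ SetLike.coe_mem _

/-- The maps `σ_{jl}` on `A₁`. -/
def σOne (j l : Fin 2) : 𝒜 1 →ₗ[k] 𝒜 1 :=
  (hB.σLin j l).restrict (hB.σ_mem j l)

theorem coe_σOne (j l : Fin 2) (a : 𝒜 1) : (hB.σOne j l a : A) = σ a j l := rfl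

theorem mulTensor_sum_σOne (r : 𝒜 1 ⊗[k] 𝒜 1) (j l : Fin 2) :
    mulTensor (𝒜 1).subtype (∑ m, TensorProduct.map (hB.σOne j m) (hB.σOne m l) r)
      = hB.σLin j l (mulTensor (𝒜 1).subtype r) := by
  induction r using TensorProduct.induction_on with
  | zero => simp
  | add x y hx hy => simp only [map_add, Finset.sum_add_distrib, hx, hy]
  | tmul a b =>
    simp only [map_sum, TensorProduct.map_tmul, mulTensor_tmul, Submodule.subtype_apply, coe_σOne]
    change _ = σ (a * b) j l
    rw [hB.σ_mul, Matrix.mul_apply]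

variable (hA : IsQuadratic 𝒜)

theorem exists_eq_tmul_induction {C : ℬ 1 ⊗[k] ℬ 1 → Prop} (zero : C 0)
    (add : ∀ x y, C x → C y → C (x + y))
    (tmul : ∀ x x', C (hB.degreeOneEquiv hA x ⊗ₜ hB.degreeOneEquiv hA x')) (x) : C x := by
  induction x using TensorProduct.induction_on with
  | zero => exact zero
  | add x y hx hy => exact add x y hx hy
  | tmul b c =>
    obtain ⟨x, rfl⟩ := (hB.degreeOneEquiv hA).surjective b
    obtain ⟨x', rfl⟩ := (hB.degreeOneEquiv hA).surjective c
    exact tmul x x'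

theorem toA_apply (x : 𝒜 1 × k × k) : hB.toA hA (hB.degreeOneEquiv hA x) = x.1 := by
  simp [toA]

/-- The coordinates on `k y₁ ⊕ k y₂`. -/
noncomputable def coordForm (j : Fin 2) : Module.Dual k (ℬ 1) :=
  (![LinearMap.fst k k k, LinearMap.snd k k k] j ∘ₗ LinearMap.snd k (𝒜 1) (k × k)) ∘ₗ
    (hB.degreeOneEquiv hA).symm.toLinearMap

theorem coordForm_apply (j : Fin 2) (x : 𝒜 1 × k × k) :
    hB.coordForm hA j (hB.degreeOneEquiv hA x) = ![x.2.1, x.2.2] j := by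
  fin_cases j <;> simp [coordForm]

theorem coe_degreeOneEquiv (x : 𝒜 1 × k × k) :
    (hB.degreeOneEquiv hA x : B) = i x.1 + x.2.1 • y₁ + x.2.2 • y₂ := rfl

/-- This bilinear form is `f` applied to the `y_l`-coefficient of the product, which vanishes on
relations. -/
theorem comm_mem_perp (f : Module.Dual k (𝒜 1)) (l : Fin 2) :
    (f ∘ₗ hB.toA hA) ⊗ₜ[k] hB.coordForm hA l
      + ∑ j, hB.coordForm hA j ⊗ₜ[k] (f ∘ₗ hB.σOne j l ∘ₗ hB.toA hA) ∈ perp (relations ℬ) := by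
  obtain ⟨P, hP⟩ := hB.exists_coeff_mul
  rw [mem_perp]
  -- The coefficient is lifted to `A₁` because `f` is defined only there.
  have key : ∀ x, ∃ v : 𝒜 1, (v : A) = P (mulTensor (ℬ 1).subtype x) (![(1, 0), (0, 1)] l) ∧
      TensorProduct.dualDistrib k _ _ ((f ∘ₗ hB.toA hA) ⊗ₜ[k] hB.coordForm hA l
      + ∑ j, hB.coordForm hA j ⊗ₜ[k] (f ∘ₗ hB.σOne j l ∘ₗ hB.toA hA)) x = f v := by
    intro x
    induction x using hB.exists_eq_tmul_induction hA with
    | zero => exact ⟨0, by simp⟩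
    | add x y hx hy =>
      obtain ⟨v, hv, hv'⟩ := hx
      obtain ⟨w, hw, hw'⟩ := hy
      exact ⟨v + w, by simp [hv, hw], by rw [map_add, hv', hw', map_add]⟩
    | tmul x x' =>
      refine ⟨![x'.2.1, x'.2.2] l • x.1 + x.2.1 • hB.σOne 0 l x'.1
        + x.2.2 • hB.σOne 1 l x'.1, ?_, ?_⟩
      · rw [mulTensor_tmul, Submodule.subtype_apply, Submodule.subtype_apply,
          coe_degreeOneEquiv, coe_degreeOneEquiv, hP]
        fin_cases l <;> simp [coe_σOne]
      · simp only [map_add, LinearMap.add_apply,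
          TensorProduct.dualDistrib_apply, coordForm_apply, LinearMap.comp_apply, toA_apply,
          Fin.sum_univ_two, map_smul, smul_eq_mul]
        simp
        ring
  intro x hx
  obtain ⟨v, hv, hv'⟩ := key x
  have hx0 : mulTensor (ℬ 1).subtype x = 0 := hx
  rw [hx0, map_zero] at hv
  have : v = 0 := Subtype.ext (by simpa using hv)
  rw [hv', this, map_zero]

theorem rel_mem_perp (l m : Fin 2) :
    hB.coordForm hA l ⊗ₜ[k] hB.coordForm hA m
      - (!![-q, -p; 1, 0] : Matrix (Fin 2) (Fin 2) k) l m •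
        (hB.coordForm hA 1 ⊗ₜ[k] hB.coordForm hA 0) ∈ perp (relations ℬ) := by
  have := hA.nontrivial
  -- For `y₂ y₁` the element is zero. It is set apart because its exponents would coincide with
  -- those of `y₁ y₂`; in the other cases the form is the coefficient of `y₁^(2-l-m) y₂^(l+m)`.
  by_cases hlm : l = 1 ∧ m = 0
  · obtain ⟨rfl, rfl⟩ := hlm
    simp
  obtain ⟨P, hP⟩ := hB.exists_coeff_mul
  rw [mem_perp]
  have key : ∀ x, algebraMap k A (TensorProduct.dualDistrib k _ _
      (hB.coordForm hA l ⊗ₜ[k] hB.coordForm hA m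
      - (!![-q, -p; 1, 0] : Matrix (Fin 2) (Fin 2) k) l m •
        (hB.coordForm hA 1 ⊗ₜ[k] hB.coordForm hA 0)) x)
      = P (mulTensor (ℬ 1).subtype x) (2 - l - m, l + m) := by
    intro x
    induction x using hB.exists_eq_tmul_induction hA with
    | zero => simp
    | add x y hx hy => simp only [map_add, hx, hy, Finsupp.add_apply]
    | tmul x x' =>
      rw [mulTensor_tmul, Submodule.subtype_apply, Submodule.subtype_apply,
          coe_degreeOneEquiv, coe_degreeOneEquiv, hP]
      simp only [map_sub, map_smul, LinearMap.sub_apply, LinearMap.smul_apply,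
        TensorProduct.dualDistrib_apply, coordForm_apply]
      fin_cases l <;> fin_cases m
      · simp
      · simp
      · simp at hlm
      · simp
  intro x hx
  have hx0 : mulTensor (ℬ 1).subtype x = 0 := hx
  have h := key x
  rw [hx0, map_zero] at h
  exact (algebraMap k A).injective (by simpa using h)

theorem y_eq_degreeOneEquiv (j : Fin 2) : (⟨![y₁, y₂] j, hB.y_mem j⟩ : ℬ 1)
    = hB.degreeOneEquiv hA (0, ![(1, 0), (0, 1)] j) := by
  apply Subtype.ext
  rw [coe_degreeOneEquiv]
  fin_cases j <;> simp

/-- The linear data of the trimmed double Ore extension. -/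
noncomputable def dualExtension : DualExtension (relations 𝒜) (relations ℬ) where
  π := hB.toA hA
  incl := (hB.degreeOneEquiv hA).toLinearMap ∘ₗ LinearMap.inl k (𝒜 1) (k × k)
  η := hB.coordForm hA
  Y j := ⟨![y₁, y₂] j, hB.y_mem j⟩
  s := hB.σOne
  ρ := !![-q, -p; 1, 0]
  D := ∑ j, ∑ n, (!![-q, -p; 1, 0] : Matrix (Fin 2) (Fin 2) k) j n •
    (hB.σOne j 1 ∘ₗ hB.σOne n 0)
  π_incl a := hB.toA_apply hA (a, 0, 0)
  π_Y j := by
    rw [hB.y_eq_degreeOneEquiv hA, toA_apply]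
  η_incl j a := by
    refine (hB.coordForm_apply hA j (a, 0, 0)).trans ?_
    fin_cases j <;> rfl
  η_Y j l := by
    rw [hB.y_eq_degreeOneEquiv hA, coordForm_apply]
    fin_cases j <;> fin_cases l <;> simp
  decomp x := by
    obtain ⟨⟨a, s, t⟩, rfl⟩ := (hB.degreeOneEquiv hA).surjective x
    apply Subtype.ext
    rw [toA_apply]
    simp only [coordForm_apply, Fin.sum_univ_two, LinearMap.comp_apply, LinearEquiv.coe_coe,
      Submodule.coe_add, Submodule.coe_smul, coe_degreeOneEquiv, LinearMap.inl_apply]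
    simp [add_assoc]
  s_mem r hr j l := by
    have hr0 : mulTensor (𝒜 1).subtype r = 0 := hr
    change mulTensor (𝒜 1).subtype _ = 0
    rw [mulTensor_sum_σOne, hr0, map_zero]
  ρ_one_zero := rfl
  ρ_one_one := rfl
  s_ρ l m := by
    ext a
    have h := hB.σ_rel (a : A) l m
    simp only [Fin.sum_univ_two, LinearMap.add_apply, LinearMap.smul_apply, LinearMap.comp_apply,
      Submodule.coe_add, Submodule.coe_smul, coe_σOne] at h ⊢
    exact h.symm
  map_π_mem := hB.map_toA_mem_relations hA
  map_incl_mem r hr := by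
    have hr0 : mulTensor (𝒜 1).subtype r = 0 := hr
    have e : (ℬ 1).subtype ∘ₗ (hB.degreeOneEquiv hA).toLinearMap ∘ₗ LinearMap.inl k (𝒜 1) (k × k)
        = i.toLinearMap ∘ₗ (𝒜 1).subtype := by
      ext a
      change (hB.degreeOneEquiv hA (a, 0, 0) : B) = _
      rw [coe_degreeOneEquiv]
      simp
    change mulTensor (ℬ 1).subtype _ = 0
    rw [mulTensor_comp_map, e]
    change mulTensor _ r = 0
    rw [mulTensor_algHom_comp, hr0, map_zero]
  comm_mem j a := by
    change mulTensor (ℬ 1).subtype _ = 0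
    have e : ∀ a, (hB.degreeOneEquiv hA (a, 0, 0) : B) = i a := by
      intro a
      rw [coe_degreeOneEquiv]
      simp
    have h := hB.comm j a
    simp only [map_sub, map_add, mulTensor_tmul, Submodule.subtype_apply, LinearMap.comp_apply,
      LinearEquiv.coe_coe, LinearMap.inl_apply, Fin.sum_univ_two]
    refine sub_eq_zero.2 ((congrArg (![y₁, y₂] j * ·) (e a)).trans (h.trans ?_))
    exact (congrArg₂ (fun b c => b * y₁ + c * y₂) (e (hB.σOne j 0 a)) (e (hB.σOne j 1 a))).symm
  rel_mem := by
    change mulTensor (ℬ 1).subtype _ = 0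
    have h := hB.rel
    simp only [Fin.sum_univ_two, map_add, map_smul, mulTensor_tmul, Submodule.subtype_apply]
    simp [h]
  comm_perp := hB.comm_mem_perp hA
  rel_perp := hB.rel_mem_perp hA

/-! ### Consequences of the left double Ore structure -/

omit [GradedAlgebra 𝒜] [GradedAlgebra ℬ] in
theorem ne_zero_of_isLeftDoubleOre (hL : IsLeftDoubleOre i y₁ y₂) [Nontrivial A] : p ≠ 0 := by
  rintro rfl
  obtain ⟨p', q', τ₀, τ₁, τ₂, h⟩ := hL.relation
  obtain ⟨P, -, hP⟩ := hB.exists_coeff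
  rw [hB.rel] at h
  -- If `p = 0`, then `y₂ y₁ = q y₁²`, so the left relation expresses `y₁ y₂` through other basis
  -- monomials; its own coefficient `1` would be zero.
  have h2 : i 1 * (y₁ ^ 1 * y₂ ^ 1) = i (algebraMap k A (p' * q + q')) * (y₁ ^ 2 * y₂ ^ 0)
      + i τ₁ * (y₁ ^ 1 * y₂ ^ 0) + i τ₂ * (y₁ ^ 0 * y₂ ^ 1) + i τ₀ * (y₁ ^ 0 * y₂ ^ 0) := by
    rw [AlgHom.commutes, ← Algebra.smul_def, add_smul, mul_smul]
    simpa [pow_two] using h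
  generalize algebraMap k A (p' * q + q') = c at h2
  have h3 := DFunLike.congr_fun (congrArg P h2) (1, 1)
  simp only [map_add, hP] at h3
  simp at h3

/-- Write `a y_l = y₁ a₁ + y₂ a₂ + a₀`, take components of degree two and move the `y`'s to the
right. The coefficients of `y₁` and `y₂` show that the degree-one parts of `a₁, a₂` are the required
`u`. -/
theorem σOne_column_surjective (hL : IsLeftDoubleOre i y₁ y₂) (l : Fin 2) (a : 𝒜 1) :
    ∃ u : Fin 2 → 𝒜 1, ∀ m, ∑ j, hB.σOne j m (u j) = if m = l then a else 0 := by
  obtain ⟨a₁, a₂, a₀, h⟩ : ∃ a₁ a₂ a₀ : A,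
      i a * ![y₁, y₂] l = y₁ * i a₁ + y₂ * i a₂ + i a₀ := by
    fin_cases l
    · exact hL.comm₁ a
    · exact hL.comm₂ a
  have h2 := congrArg (fun b => (DirectSum.decompose ℬ b 2 : B)) h
  simp only [DirectSum.decompose_add, DirectSum.add_apply, Submodule.coe_add,
    hB.decompose_map_mul _ (hB.y_mem l), hB.decompose_mul_map _ hB.y₁_mem,
    hB.decompose_mul_map _ hB.y₂_mem, hB.decompose_map,
    DirectSum.decompose_of_mem_same _ a.2] at h2
  refine ⟨![DirectSum.decompose 𝒜 a₁ 1, DirectSum.decompose 𝒜 a₂ 1], ?_⟩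
  have hc₁ : ∀ a, y₁ * i a = i (σ a 0 0) * y₁ + i (σ a 0 1) * y₂ := hB.comm 0
  have hc₂ : ∀ a, y₂ * i a = i (σ a 1 0) * y₁ + i (σ a 1 1) * y₂ := hB.comm 1
  rw [hc₁, hc₂] at h2
  have h3 : i 0 + i (if 0 = l then (a : A) else 0) * y₁ + i (if 1 = l then (a : A) else 0) * y₂
      = i (DirectSum.decompose 𝒜 a₀ 2)
        + i (σ (DirectSum.decompose 𝒜 a₁ 1) 0 0 + σ (DirectSum.decompose 𝒜 a₂ 1) 1 0) * y₁
        + i (σ (DirectSum.decompose 𝒜 a₁ 1) 0 1 + σ (DirectSum.decompose 𝒜 a₂ 1) 1 1) * y₂ := by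
    have e : i 0 + i (if 0 = l then (a : A) else 0) * y₁ + i (if 1 = l then (a : A) else 0) * y₂
        = i a * ![y₁, y₂] l := by
      fin_cases l <;> simp
    rw [e, h2]
    simp only [map_add, add_mul]
    abel
  obtain ⟨-, h4, h5⟩ := hB.eq_of_linear h3
  intro m
  apply Subtype.ext
  fin_cases m
  · simp only [Fin.sum_univ_two, Submodule.coe_add, coe_σOne, Matrix.cons_val_zero,
      Matrix.cons_val_one]
    fin_cases l <;> simpa using h4.symm
  · simp only [Fin.sum_univ_two, Submodule.coe_add, coe_σOne, Matrix.cons_val_zero,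
      Matrix.cons_val_one]
    fin_cases l <;> simpa using h5.symm

end IsTrimmedRightDoubleOre

end KoszulOre

open KoszulOre in
theorem proposition2 {k : Type u} [Field k]
    {A : Type v} [Ring A] [Algebra k A] (𝒜 : ℕ → Submodule k A) [GradedAlgebra 𝒜]
    {B : Type w} [Ring B] [Algebra k B] (ℬ : ℕ → Submodule k B) [GradedAlgebra ℬ]
    (i : A →ₐ[k] B) (y₁ y₂ : B) (p q : k) (σ : A → Matrix (Fin 2) (Fin 2) A)
    (hA : IsKoszul 𝒜) (hB : IsTrimmedRightDoubleOre 𝒜 ℬ i y₁ y₂ p q σ) :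
    Function.Injective (hB.dualMap hA.isQuadratic) ∧
    (p ≠ 0 →
      IsRightBasis (hB.dualMap hA.isQuadratic : KoszulDual 𝒜 →+* KoszulDual ℬ)
        ![1, hB.y₁Dual hA.isQuadratic, hB.y₂Dual hA.isQuadratic,
          hB.y₁Dual hA.isQuadratic * hB.y₂Dual hA.isQuadratic]) ∧
    (IsLeftDoubleOre i y₁ y₂ →
      IsRightBasis (hB.dualMap hA.isQuadratic : KoszulDual 𝒜 →+* KoszulDual ℬ)
        ![1, hB.y₁Dual hA.isQuadratic, hB.y₂Dual hA.isQuadratic,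
          hB.y₁Dual hA.isQuadratic * hB.y₂Dual hA.isQuadratic] ∧
      IsLeftBasis (hB.dualMap hA.isQuadratic : KoszulDual 𝒜 →+* KoszulDual ℬ)
        ![1, hB.y₁Dual hA.isQuadratic, hB.y₂Dual hA.isQuadratic,
          hB.y₁Dual hA.isQuadratic * hB.y₂Dual hA.isQuadratic]) := by
  have := hA.isQuadratic.nontrivial
  have := hA.isQuadratic.finite
  let E := hB.dualExtension hA.isQuadratic
  have hright : p ≠ 0 → IsRightBasis (hB.dualMap hA.isQuadratic : KoszulDual 𝒜 →+* KoszulDual ℬ)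
        ![1, hB.y₁Dual hA.isQuadratic, hB.y₂Dual hA.isQuadratic,
          hB.y₁Dual hA.isQuadratic * hB.y₂Dual hA.isQuadratic] :=
    -- Here `ρ 0 1 = -p`, and `E.φ` and `E.y` unfold to `dualMap` and the dual variables.
    fun hp => E.isRightBasis (neg_ne_zero.2 hp)
  refine ⟨E.φ_injective, hright, fun hL => ?_⟩
  have hp := hB.ne_zero_of_isLeftDoubleOre hL
  exact ⟨hright hp, E.isLeftBasis (neg_ne_zero.2 hp) (hB.σOne_column_surjective hL)⟩
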